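/- For an integer $n\ge 0$ and a real $\lambda>0$ let $$C_n^{(\lambda)}(x)=\frac{(2\lambda)_n}{(\lambda+\frac12)_n}\,P_n^{(\lambda-\frac12,\lambda-\frac12)}(x),\qquad P_n^{(\alpha,\beta)}(x)=\frac{(\alpha+1)_n}{n!}\,{}_2F_1\!\left(-n,\;n+\alpha+\beta+1;\;\alpha+1;\;\frac{1-x}{2}\right)$$ be the Gegenbauer and Jacobi polynomials, where $(a)_n=a(a+1)\cdots(a+n-1)$. Then for every integer $n\ge 0$ the entropic integral $$E(C_n^{(3)})=-\int_{-1}^{1}\bigl(C_n^{(3)}(x)\bigr)^2\log\bigl(C_n^{(3)}(x)\bigr)^2\,(1-x^2)^{5/2}\,dx$$ (with the convention $0\log 0=0$) converges and $$\begin{aligned} E(C_n^{(3)})=-\frac{\pi}{128}\Biggl\{&2(n+1)(n+2)(n+4)(n+5)\log\left(\frac{(n+1)(n+2)}{2}\right) +\frac{n^5-16n^4-269n^3-1200n^2-2102n-1250}{n+3}\\ &+\frac{2(n+5)^2}{(n+2)(n+3)}\,\Re\Biggl[\left(\frac{(n+1)(n+5)+i\sqrt{3(n+1)(n+5)}}{(n+1)(n+2)}\right)^{n+1}\\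 &\qquad\times\left(2n^2+13n+14-i\,(n+1)(n+6)\sqrt{\frac{(n+1)(n+5)}{3}}\right)\Biggr]\Biggr\}. \end{aligned}$$ -/

import Mathlib

/-- The Jacobi polynomial `P_n^{(α,β)}(x) = (α+1)_n / n! · ₂F₁(-n, n+α+β+1; α+1; (1-x)/2)`,
as a function of the real variable `x` (the hypergeometric series terminates). -/
noncomputable def jacobiP (n : ℕ) (α β x : ℝ) : ℝ :=
  (ascPochhammer ℝ n).eval (α + 1) / (n.factorial : ℝ) *
    ordinaryHypergeometric (-(n : ℝ)) ((n : ℝ) + α + β + 1) (α + 1) ((1 - x) / 2)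

/-- The Gegenbauer polynomial
`C_n^{(lam)}(x) = (2 lam)_n / (lam + 1/2)_n · P_n^{(lam - 1/2, lam - 1/2)}(x)`. -/
noncomputable def gegenbauerC (n : ℕ) (lam x : ℝ) : ℝ :=
  (ascPochhammer ℝ n).eval (2 * lam) / (ascPochhammer ℝ n).eval (lam + 1 / 2) *
    jacobiP n (lam - 1 / 2) (lam - 1 / 2) x

/-- The function `C_n^{(lam)}(x)² log (C_n^{(lam)}(x)²) (1 - x²)^{lam - 1/2}`, with `0 log 0 = 0`. -/
noncomputable def gegenbauerEntropyIntegrand (n : ℕ) (lam x : ℝ) : ℝ :=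
  gegenbauerC n lam x ^ 2 * Real.log (gegenbauerC n lam x ^ 2) *
    (1 - x ^ 2) ^ (lam - 1 / 2)

/-- The entropic integral `E(C_n^{(lam)})`. -/
noncomputable def gegenbauerEntropy (n : ℕ) (lam : ℝ) : ℝ :=
  -∫ x in (-1 : ℝ)..1, gegenbauerEntropyIntegrand n lam x

/-! With x = cos θ, z = e^{iθ} and w = z² = e^{iφ}, z^n C_n(x) becomes a polynomial P_n(w), and
|C_n(cos θ)| = |P_n(w)|. The entropy is therefore the pairing of log|P_n(e^{iφ})| with the
trigonometric polynomial 64 C_n² sin⁶θ, which has degree n+3 in φ. Only the Fourier coefficients of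
log|P_n| up to order n+3 matter.

All zeros ζ of P_n lie on the unit circle (`norm_eq_one_of_gegenbauerCirclePoly_root`). The mean of
log|P_n| is thus log P_n(0), and its cosine coefficients are governed by the power sums p_k = ∑
ζ^{-k} (`integral_log_norm_gegenbauerCirclePoly_mul_cos`).

These power sums are explicit. By `one_sub_pow_five_mul_gegenbauerCirclePoly_eval`, (1-w)⁵ P_n(w) is
a quadratic Q(w) minus w^{n+3} times its reversal. If 1/ρ and 1/ρ' are the roots of Q, comparing
logarithmic derivatives modulo w^{n+3} gives p_k = ρ^k + ρ'^k - 5 for 1 ≤ k < n+3. At k = n+3 one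
explicit correction appears (`sum_inv_pow_roots_gegenbauerCirclePoly`).

What remains is a finite sum of a quadratic in k times ρ^k, evaluated in closed form with s =
1/(ρ-1). Since ρ' is the conjugate of ρ, the answer is a real part. -/

open scoped Topology

/-! ### Three-term recurrence for C_n^{(3)}. -/

/-- The coefficient of `((1 - x) / 2) ^ k` in `C_n^{(3)}(x)`. -/
noncomputable def gegenbauerCoeff (n k : ℕ) : ℝ :=
  (ascPochhammer ℝ (n + k)).eval 6 * (ascPochhammer ℝ k).eval (-(n : ℝ)) /
    (n.factorial * k.factorial * (ascPochhammer ℝ k).eval (7 / 2))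

theorem ascPochhammer_eval_add (n k : ℕ) (a : ℝ) :
    (ascPochhammer ℝ (n + k)).eval a =
      (ascPochhammer ℝ n).eval a * (ascPochhammer ℝ k).eval (a + n) := by
  rw [← ascPochhammer_mul]
  simp [Polynomial.eval_comp]

theorem ascPochhammer_succ_eval_left (k : ℕ) (a : ℝ) :
    (ascPochhammer ℝ (k + 1)).eval a = a * (ascPochhammer ℝ k).eval (a + 1) := by
  rw [add_comm k 1, ascPochhammer_eval_add]
  simp

/-- The cutoff N is free, so that polynomials of different degrees can be expanded over a common
range. -/
theorem gegenbauerC_three_eq_sum (n N : ℕ) (h : n < N) (x : ℝ) :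
    gegenbauerC n 3 x = ∑ k ∈ Finset.range N, gegenbauerCoeff n k * ((1 - x) / 2) ^ k := by
  rw [gegenbauerC, jacobiP, ordinaryHypergeometric_eq_tsum]
  have h7 : ∀ k, (ascPochhammer ℝ k).eval (7 / 2 : ℝ) ≠ 0 := fun k =>
    (ascPochhammer_pos k _ (by norm_num)).ne'
  have hn : (n.factorial : ℝ) ≠ 0 := by exact_mod_cast n.factorial_ne_zero
  simp only
  rw [tsum_eq_sum (s := Finset.range N), ← mul_assoc, Finset.mul_sum]
  · refine Finset.sum_congr rfl fun k _ => ?_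
    have hk : (k.factorial : ℝ) ≠ 0 := by exact_mod_cast k.factorial_ne_zero
    have e1 : (2 * 3 : ℝ) = 6 := by norm_num
    have e2 : (3 + 1 / 2 : ℝ) = 7 / 2 := by norm_num
    have e3 : (3 - 1 / 2 + 1 : ℝ) = 7 / 2 := by norm_num
    have e4 : ((n : ℝ) + (3 - 1 / 2) + (3 - 1 / 2) + 1 : ℝ) = 6 + n := by ring
    rw [e1, e2, e3, e4, gegenbauerCoeff, ascPochhammer_eval_add, smul_eq_mul]
    have := h7 k
    have := h7 n
    field_simp
  · intro k hk
    have hk : n < k := by simp at hk; omega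
    rw [ascPochhammer_eval_neg_coe_nat_of_lt hk]
    simp

theorem gegenbauerCoeff_zero_right (n : ℕ) :
    gegenbauerCoeff n 0 = (ascPochhammer ℝ n).eval 6 / n.factorial := by
  simp [gegenbauerCoeff]

theorem gegenbauerCoeff_recurrence_zero (n : ℕ) :
    ((n : ℝ) + 2) * gegenbauerCoeff (n + 2) 0 =
      2 * (n + 4) * gegenbauerCoeff (n + 1) 0 - (n + 6) * gegenbauerCoeff n 0 := by
  have hn : (n.factorial : ℝ) ≠ 0 := by exact_mod_cast n.factorial_ne_zero
  have h1 : (n : ℝ) + 1 ≠ 0 := by positivity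
  have h2 : (n : ℝ) + 2 ≠ 0 := by positivity
  simp only [gegenbauerCoeff_zero_right, ascPochhammer_succ_eval, Nat.factorial_succ]
  push_cast
  rw [show (n : ℝ) + 1 + 1 = n + 2 by ring]
  field_simp
  ring

/-- This is the coefficient of y^{k+1} in the three-term recurrence, with y = (1-x)/2 and x = 1 -
2y. -/
theorem gegenbauerCoeff_recurrence_succ (n k : ℕ) :
    ((n : ℝ) + 2) * gegenbauerCoeff (n + 2) (k + 1) =
      2 * (n + 4) * (gegenbauerCoeff (n + 1) (k + 1) - 2 * gegenbauerCoeff (n + 1) k)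
        - (n + 6) * gegenbauerCoeff n (k + 1) := by
  have hn : (n.factorial : ℝ) ≠ 0 := by exact_mod_cast n.factorial_ne_zero
  have hk : (k.factorial : ℝ) ≠ 0 := by exact_mod_cast k.factorial_ne_zero
  have h1 : (n : ℝ) + 1 ≠ 0 := by positivity
  have h2 : (n : ℝ) + 2 ≠ 0 := by positivity
  have h3 : (k : ℝ) + 1 ≠ 0 := by positivity
  have h7 : ∀ k, (ascPochhammer ℝ k).eval (7 / 2 : ℝ) ≠ 0 := fun k =>
    (ascPochhammer_pos k _ (by norm_num)).ne'
  have h8 : (7 / 2 : ℝ) + k ≠ 0 := by positivity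
  -- All four Pochhammer values share the factor v = (-n)_{k-1}; for k = 0 it is read as (-n)_{-1} =
  -- -1/(n+1).
  have key : ∃ v : ℝ, (ascPochhammer ℝ (k + 1)).eval (-(n : ℝ)) = v * (k - 1 - n) * (k - n) ∧
      (ascPochhammer ℝ (k + 1)).eval (-((n : ℝ) + 1)) = -(n + 1) * v * (k - 1 - n) ∧
      (ascPochhammer ℝ (k + 1)).eval (-((n : ℝ) + 2)) = (n + 1) * (n + 2) * v ∧
      (ascPochhammer ℝ k).eval (-((n : ℝ) + 1)) = -(n + 1) * v := by
    rcases k with _ | k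
    · refine ⟨-1 / (n + 1), ?_, ?_, ?_, ?_⟩ <;> simp <;> field_simp <;> ring
    · refine ⟨(ascPochhammer ℝ k).eval (-(n : ℝ)), ?_, ?_, ?_, ?_⟩
      · simp only [ascPochhammer_succ_eval]; push_cast; ring
      · rw [ascPochhammer_succ_eval_left, show -((n : ℝ) + 1) + 1 = -n by ring,
          ascPochhammer_succ_eval]; push_cast; ring
      · rw [ascPochhammer_succ_eval_left, ascPochhammer_succ_eval_left,
          show -((n : ℝ) + 2) + 1 + 1 = -n by ring]; ring
      · rw [ascPochhammer_succ_eval_left, show -((n : ℝ) + 1) + 1 = -n by ring]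
  obtain ⟨v, e1, e2, e3, e4⟩ := key
  have := h7 k
  simp only [gegenbauerCoeff]
  push_cast
  rw [e1, e2, e3, e4, show n + 2 + (k + 1) = n + k + 1 + 1 + 1 by ring,
    show n + 1 + (k + 1) = n + k + 1 + 1 by ring, show n + 1 + k = n + k + 1 by ring,
    show n + (k + 1) = n + k + 1 by ring]
  simp only [ascPochhammer_succ_eval, Nat.factorial_succ]
  push_cast
  rw [show (n : ℝ) + 1 + 1 = n + 2 by ring]
  field_simp
  ring

theorem gegenbauerC_three_zero (x : ℝ) : gegenbauerC 0 3 x = 1 := by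
  rw [gegenbauerC_three_eq_sum 0 1 one_pos]
  simp [gegenbauerCoeff]

theorem gegenbauerC_three_one (x : ℝ) : gegenbauerC 1 3 x = 6 * x := by
  rw [gegenbauerC_three_eq_sum 1 2 one_lt_two]
  simp [gegenbauerCoeff, Finset.sum_range_succ, ascPochhammer_succ_eval]
  ring

theorem gegenbauerC_three_recurrence (n : ℕ) (x : ℝ) :
    ((n : ℝ) + 2) * gegenbauerC (n + 2) 3 x =
      2 * (n + 4) * x * gegenbauerC (n + 1) 3 x - (n + 6) * gegenbauerC n 3 x := by
  rw [gegenbauerC_three_eq_sum (n + 2) (n + 4) (by omega),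
    gegenbauerC_three_eq_sum n (n + 4) (by omega)]
  have hx : 2 * ((n : ℝ) + 4) * x * gegenbauerC (n + 1) 3 x =
      2 * (n + 4) * gegenbauerC (n + 1) 3 x
        - 4 * (n + 4) * (((1 - x) / 2) * gegenbauerC (n + 1) 3 x) := by ring
  rw [hx]
  nth_rw 1 [gegenbauerC_three_eq_sum (n + 1) (n + 4) (by omega)]
  rw [gegenbauerC_three_eq_sum (n + 1) (n + 3) (by omega)]
  simp only [Finset.sum_range_succ' _ (n + 3), pow_zero, mul_one, mul_add, Finset.mul_sum]
  rw [gegenbauerCoeff_recurrence_zero]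
  have : ∀ k ∈ Finset.range (n + 3),
      ((n : ℝ) + 2) * (gegenbauerCoeff (n + 2) (k + 1) * ((1 - x) / 2) ^ (k + 1)) =
      2 * (n + 4) * (gegenbauerCoeff (n + 1) (k + 1) * ((1 - x) / 2) ^ (k + 1)) -
      4 * (n + 4) * ((1 - x) / 2 * (gegenbauerCoeff (n + 1) k * ((1 - x) / 2) ^ k)) -
      (n + 6) * (gegenbauerCoeff n (k + 1) * ((1 - x) / 2) ^ (k + 1)) := by
    intro k _
    rw [← mul_assoc, gegenbauerCoeff_recurrence_succ]
    ring
  rw [Finset.sum_congr rfl this, Finset.sum_sub_distrib, Finset.sum_sub_distrib]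
  simp only [← Finset.mul_sum, ← mul_add]
  ring

/-! ### The polynomial P_n on the circle and its closed form. -/

/-- The polynomial `P_n` with `P_n(z²) = z ^ n * C_n^{(3)}((z + z⁻¹) / 2)`. -/
noncomputable def gegenbauerCirclePoly : ℕ → Polynomial ℂ
  | 0 => 1
  | 1 => 3 * (1 + Polynomial.X)
  | n + 2 => Polynomial.C ((n : ℂ) + 2)⁻¹ *
      (Polynomial.C ((n : ℂ) + 4) * (1 + Polynomial.X) * gegenbauerCirclePoly (n + 1)
        - Polynomial.C ((n : ℂ) + 6) * Polynomial.X * gegenbauerCirclePoly n)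

theorem gegenbauerCirclePoly_recurrence (n : ℕ) (w : ℂ) :
    ((n : ℂ) + 2) * (gegenbauerCirclePoly (n + 2)).eval w =
      (n + 4) * (1 + w) * (gegenbauerCirclePoly (n + 1)).eval w
        - (n + 6) * w * (gegenbauerCirclePoly n).eval w := by
  have h2 : (n : ℂ) + 2 ≠ 0 := by exact_mod_cast (by omega : n + 2 ≠ 0)
  rw [gegenbauerCirclePoly]
  simp only [Polynomial.eval_mul, Polynomial.eval_sub, Polynomial.eval_add, Polynomial.eval_C,
    Polynomial.eval_X, Polynomial.eval_one]
  rw [mul_inv_cancel_left₀ h2]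

theorem gegenbauerC_three_eq_eval (n : ℕ) (x : ℝ) (z : ℂ) (h : z ^ 2 + 1 = 2 * x * z) :
    z ^ n * (gegenbauerC n 3 x : ℂ) = (gegenbauerCirclePoly n).eval (z ^ 2) := by
  induction n using Nat.twoStepInduction with
  | zero => simp [gegenbauerC_three_zero, gegenbauerCirclePoly]
  | one =>
    simp [gegenbauerC_three_one, gegenbauerCirclePoly]
    linear_combination (-3) * h
  | more n ih0 ih1 =>
    have h2 : (n : ℂ) + 2 ≠ 0 := by exact_mod_cast (by omega : n + 2 ≠ 0)
    have hr := congrArg (fun t : ℝ => (t : ℂ)) (gegenbauerC_three_recurrence n x)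
    push_cast at hr
    refine mul_left_cancel₀ h2 ?_
    rw [gegenbauerCirclePoly_recurrence, ← ih0, ← ih1]
    linear_combination z ^ (n + 2) * hr - (n + 4) * z ^ (n + 1) * gegenbauerC (n + 1) 3 x * h

/-- Both sides obey the same recurrence in n. The gap between the quadratic and its reversal,
shifted by w^{n+3}, is what makes the low power sums of the zeros computable. -/
theorem one_sub_pow_five_mul_gegenbauerCirclePoly_eval (n : ℕ) (w : ℂ) :
    (1 - w) ^ 5 * (gegenbauerCirclePoly n).eval w =
      (((n : ℂ) + 1) * (n + 2) - 2 * (n + 1) * (n + 5) * w + (n + 4) * (n + 5) * w ^ 2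
        - w ^ (n + 3) * ((n + 4) * (n + 5) - 2 * (n + 1) * (n + 5) * w
          + (n + 1) * (n + 2) * w ^ 2)) / 2 := by
  induction n using Nat.twoStepInduction with
  | zero => simp [gegenbauerCirclePoly]; ring
  | one => simp [gegenbauerCirclePoly]; ring
  | more n ih0 ih1 =>
    have h2 : (n : ℂ) + 2 ≠ 0 := by exact_mod_cast (by omega : n + 2 ≠ 0)
    have hr := gegenbauerCirclePoly_recurrence n w
    refine mul_left_cancel₀ h2 ?_
    push_cast at *
    linear_combination (1 - w) ^ 5 * hr + (n + 4) * (1 + w) * ih1 - (n + 6) * w * ih0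

theorem gegenbauerCirclePoly_eval_zero (n : ℕ) :
    (gegenbauerCirclePoly n).eval 0 = ((n : ℂ) + 1) * (n + 2) / 2 := by
  have := one_sub_pow_five_mul_gegenbauerCirclePoly_eval n 0
  simpa using this

theorem gegenbauerCirclePoly_eval_zero_ne (n : ℕ) : (gegenbauerCirclePoly n).eval 0 ≠ 0 := by
  rw [gegenbauerCirclePoly_eval_zero]
  have h1 : (n : ℂ) + 1 ≠ 0 := by exact_mod_cast (by omega : n + 1 ≠ 0)
  have h2 : (n : ℂ) + 2 ≠ 0 := by exact_mod_cast (by omega : n + 2 ≠ 0)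
  simp [h1, h2]

/-! ### The zeros of P_n lie on the unit circle. -/

/-- The norms ‖c n‖ are nondecreasing, because 2(n+4) - (n+6) = n+2. -/
theorem gegenbauer_recurrence_ne_zero_of_one_le_norm {c : ℕ → ℂ} {x : ℂ} (h0 : c 0 = 1)
    (h1 : c 1 = 6 * x)
    (h : ∀ n : ℕ, ((n : ℂ) + 2) * c (n + 2) = 2 * (n + 4) * x * c (n + 1) - (n + 6) * c n)
    (hx : 1 ≤ ‖x‖) (n : ℕ) : c n ≠ 0 := by
  have key : ∀ n, 0 < ‖c n‖ ∧ ‖c n‖ ≤ ‖c (n + 1)‖ := by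
    intro n
    induction n with
    | zero =>
      simp only [h0, zero_add, h1, norm_one, norm_mul]
      norm_num
      linarith
    | succ n ih =>
      refine ⟨ih.1.trans_le ih.2, ?_⟩
      have e : ‖((n : ℂ) + 2) * c (n + 2)‖ = ((n : ℝ) + 2) * ‖c (n + 2)‖ := by
        rw [norm_mul]; norm_cast
      have e1 : ‖2 * ((n : ℂ) + 4) * x * c (n + 1)‖ = 2 * ((n : ℝ) + 4) * ‖x‖ * ‖c (n + 1)‖ := by
        rw [norm_mul, norm_mul]; norm_cast
      have e2 : ‖((n : ℂ) + 6) * c n‖ = ((n : ℝ) + 6) * ‖c n‖ := by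
        rw [norm_mul]; norm_cast
      have ht := norm_sub_norm_le (2 * ((n : ℂ) + 4) * x * c (n + 1)) (((n : ℂ) + 6) * c n)
      rw [← h, e, e1, e2] at ht
      have hn : (0 : ℝ) ≤ n := n.cast_nonneg
      have b1 : 2 * ((n : ℝ) + 4) * ‖c (n + 1)‖ ≤ 2 * ((n : ℝ) + 4) * ‖x‖ * ‖c (n + 1)‖ := by
        have := mul_le_mul_of_nonneg_left hx (by positivity : 0 ≤ 2 * ((n : ℝ) + 4) * ‖c (n + 1)‖)
        linarith
      have b2 : ((n : ℝ) + 6) * ‖c n‖ ≤ ((n : ℝ) + 6) * ‖c (n + 1)‖ := by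
        gcongr
        exact ih.2
      have hpos : (0 : ℝ) < n + 2 := by positivity
      refine le_of_mul_le_mul_left ?_ hpos
      linarith
  exact norm_pos_iff.1 (key n).1

/-- The ratio r = c (n+1) / c n keeps its imaginary part on the side of Im x: the recurrence gives
the next ratio as a positive multiple of x minus a positive multiple of 1/r, and -1/r lies in the
same half-plane as r. -/
theorem gegenbauer_recurrence_ne_zero_of_im_ne_zero {c : ℕ → ℂ} {x : ℂ} (h0 : c 0 = 1)
    (h1 : c 1 = 6 * x)
    (h : ∀ n : ℕ, ((n : ℂ) + 2) * c (n + 2) = 2 * (n + 4) * x * c (n + 1) - (n + 6) * c n)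
    (hx : x.im ≠ 0) (n : ℕ) : c n ≠ 0 := by
  have key : ∀ n, c n ≠ 0 ∧ 0 < x.im * (c (n + 1) / c n).im := by
    intro n
    induction n with
    | zero =>
      simp only [h0, zero_add, h1, div_one]
      refine ⟨one_ne_zero, ?_⟩
      have : (6 * x).im = 6 * x.im := by simp
      rw [this]
      have := mul_self_pos.2 hx
      linarith
    | succ n ih =>
      obtain ⟨hc, hr⟩ := ih
      have hc1 : c (n + 1) ≠ 0 := by
        intro h'
        simp [h'] at hr
      refine ⟨hc1, ?_⟩
      set r := c (n + 1) / c n with hrdef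
      have hr0 : r ≠ 0 := div_ne_zero hc1 hc
      have hpos : (0 : ℝ) < n + 2 := by positivity
      have e : (((n : ℝ) + 2 : ℝ) : ℂ) * (c (n + 2) / c (n + 1)) =
          ((2 * ((n : ℝ) + 4) : ℝ) : ℂ) * x - (((n : ℝ) + 6 : ℝ) : ℂ) * r⁻¹ := by
        rw [hrdef, inv_div]
        field_simp
        push_cast
        linear_combination h n
      have e' := congrArg Complex.im e
      rw [Complex.sub_im, Complex.im_ofReal_mul, Complex.im_ofReal_mul, Complex.im_ofReal_mul,
        Complex.inv_im] at e'
      have hns := Complex.normSq_pos.2 hr0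
      have e'' : ((n : ℝ) + 2) * (x.im * (c (n + 1 + 1) / c (n + 1)).im) =
          2 * (n + 4) * (x.im * x.im) + (n + 6) * ((x.im * r.im) / Complex.normSq r) := by
        linear_combination x.im * e'
      have p1 := mul_self_pos.2 hx
      have p2 := div_pos hr hns
      have : 0 < ((n : ℝ) + 2) * (x.im * (c (n + 1 + 1) / c (n + 1)).im) := by
        rw [e'']; positivity
      exact (mul_pos_iff_of_pos_left hpos).1 this
  exact (key n).1

/-- For |t| < 1 the quadratic z² - 2tz + 1 has two conjugate nonreal roots with product 1. -/
theorem norm_eq_one_of_add_inv_real {z : ℂ} {t : ℝ} (ht : |t| < 1) (h : z ^ 2 + 1 = 2 * t * z) :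
    ‖z‖ = 1 := by
  have hre := congrArg Complex.re h
  have him := congrArg Complex.im h
  simp [pow_two] at hre him
  have ht' := (sq_lt_one_iff_abs_lt_one t).2 ht
  have hb : z.im ≠ 0 := by
    intro hb
    rw [hb] at hre
    nlinarith [sq_nonneg (z.re - t)]
  have ha : z.re = t := by
    have : z.im * (z.re - t) = 0 := by linarith
    rcases mul_eq_zero.1 this with h | h
    · exact absurd h hb
    · linarith
  have : ‖z‖ ^ 2 = 1 := by
    rw [← Complex.normSq_eq_norm_sq, Complex.normSq_apply]
    rw [← ha] at hre
    linarith
  exact (pow_eq_one_iff_of_nonneg (norm_nonneg z) two_ne_zero).1 this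

theorem norm_eq_one_of_gegenbauerCirclePoly_root {n : ℕ} {w : ℂ}
    (hw : (gegenbauerCirclePoly n).eval w = 0) : ‖w‖ = 1 := by
  have hw0 : w ≠ 0 := by
    rintro rfl
    exact gegenbauerCirclePoly_eval_zero_ne n hw
  obtain ⟨z, rfl⟩ : ∃ z : ℂ, z ^ 2 = w := IsAlgClosed.exists_pow_nat_eq w two_pos
  have hz : z ≠ 0 := by
    rintro rfl
    simp at hw0
  set x : ℂ := (z ^ 2 + 1) / (2 * z) with hx
  have hxz : z ^ 2 + 1 = 2 * x * z := by
    rw [hx]; field_simp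
  set c : ℕ → ℂ := fun n => (gegenbauerCirclePoly n).eval (z ^ 2) / z ^ n with hc
  have c0 : c 0 = 1 := by simp [hc, gegenbauerCirclePoly]
  have c1 : c 1 = 6 * x := by
    simp [hc, gegenbauerCirclePoly, hx]
    field_simp
    ring
  have hrec : ∀ n : ℕ,
      ((n : ℂ) + 2) * c (n + 2) = 2 * (n + 4) * x * c (n + 1) - (n + 6) * c n := by
    intro n
    have := gegenbauerCirclePoly_recurrence n (z ^ 2)
    have hmul : ∀ j, z ^ j * c j = (gegenbauerCirclePoly j).eval (z ^ 2) := fun j =>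
      mul_div_cancel₀ _ (pow_ne_zero j hz)
    rw [← hmul, ← hmul, ← hmul] at this
    refine mul_left_cancel₀ (pow_ne_zero (n + 2) hz) ?_
    linear_combination this + (n + 4) * z ^ (n + 1) * c (n + 1) * hxz
  have hcn : c n = 0 := by simp [hc, hw]
  have him : x.im = 0 := by
    by_contra h
    exact gegenbauer_recurrence_ne_zero_of_im_ne_zero c0 c1 hrec h n hcn
  have hlt : ‖x‖ < 1 := by
    by_contra h
    exact gegenbauer_recurrence_ne_zero_of_one_le_norm c0 c1 hrec (not_lt.1 h) n hcn
  have hxr : x = (x.re : ℂ) := Complex.ext (by simp) (by simp [him])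
  rw [hxr] at hxz hlt
  rw [Complex.norm_real, Real.norm_eq_abs] at hlt
  rw [norm_pow, norm_eq_one_of_add_inv_real hlt hxz, one_pow]

/-! ### Power sums of the zeros via logarithmic derivatives. -/

/-- The generating series `∑_{k ≥ 1} (∑_{ζ ∈ s} ζ⁻ᵏ) X ^ k`. -/
noncomputable def invPowerSumSeries (s : Multiset ℂ) : PowerSeries ℂ :=
  PowerSeries.mk fun k => if k = 0 then 0 else (s.map fun ζ => ζ⁻¹ ^ k).sum

theorem sub_C_mul_invPowerSumSeries_singleton {ζ : ℂ} (h : ζ ≠ 0) :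
    (PowerSeries.X - PowerSeries.C ζ) * invPowerSumSeries {ζ} = -PowerSeries.X := by
  ext k
  rw [sub_mul]
  rcases k with _ | _ | k
  · simp [invPowerSumSeries]
  · rw [map_sub, PowerSeries.coeff_succ_X_mul]
    simp [invPowerSumSeries, h]
  · rw [map_sub, PowerSeries.coeff_succ_X_mul]
    simp [invPowerSumSeries, PowerSeries.coeff_X]
    field_simp
    ring

theorem invPowerSumSeries_cons (ζ : ℂ) (s : Multiset ℂ) :
    invPowerSumSeries (ζ ::ₘ s) = invPowerSumSeries {ζ} + invPowerSumSeries s := by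
  ext k
  simp only [invPowerSumSeries, map_add, PowerSeries.coeff_mk]
  split_ifs <;> simp

/-- The logarithmic derivative adds over factors, and X/(X-ζ) = -∑_{k≥1} ζ^{-k} X^k. -/
theorem X_mul_derivative_prod_eq (s : Multiset ℂ) (hs : ∀ ζ ∈ s, ζ ≠ 0) :
    ((Polynomial.X * Polynomial.derivative (s.map fun ζ => Polynomial.X - Polynomial.C ζ).prod :
        Polynomial ℂ) : PowerSeries ℂ) =
      -(((s.map fun ζ => Polynomial.X - Polynomial.C ζ).prod : Polynomial ℂ) : PowerSeries ℂ)
        * invPowerSumSeries s := by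
  induction s using Multiset.induction_on with
  | empty =>
    have : invPowerSumSeries 0 = 0 := by ext k; simp [invPowerSumSeries]
    simp [this]
  | cons ζ s ih =>
    have ih := ih fun ξ hξ => hs ξ (Multiset.mem_cons_of_mem hξ)
    have h1 := sub_C_mul_invPowerSumSeries_singleton (hs ζ (Multiset.mem_cons_self ζ s))
    rw [Multiset.map_cons, Multiset.prod_cons, invPowerSumSeries_cons, Polynomial.derivative_mul]
    push_cast at ih ⊢
    simp only [Polynomial.derivative_sub, Polynomial.derivative_X, Polynomial.derivative_C,
      sub_zero, Polynomial.coe_one]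
    linear_combination (PowerSeries.X - PowerSeries.C ζ) * ih
      + (((s.map fun ζ => Polynomial.X - Polynomial.C ζ).prod : Polynomial ℂ) : PowerSeries ℂ) * h1

theorem X_mul_derivative_C_mul_prod_eq (c : ℂ) (s : Multiset ℂ) (hs : ∀ ζ ∈ s, ζ ≠ 0)
    (p : Polynomial ℂ)
    (hp : p = Polynomial.C c * (s.map fun ζ => Polynomial.X - Polynomial.C ζ).prod) :
    ((Polynomial.X * Polynomial.derivative p : Polynomial ℂ) : PowerSeries ℂ) =
      -(p : PowerSeries ℂ) * invPowerSumSeries s := by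
  have := X_mul_derivative_prod_eq s hs
  rw [hp]
  simp only [Polynomial.derivative_C_mul]
  push_cast at this ⊢
  linear_combination PowerSeries.C c * this

/-- If two polynomials agree modulo `X ^ m`, so do the generating series of the negative power sums
of their roots. -/
theorem invPowerSumSeries_sub_eq {c d : ℂ} {s t : Multiset ℂ} {p q B : Polynomial ℂ} {m : ℕ}
    (hs : ∀ ζ ∈ s, ζ ≠ 0) (ht : ∀ ζ ∈ t, ζ ≠ 0)
    (hp : p = Polynomial.C c * (s.map fun ζ => Polynomial.X - Polynomial.C ζ).prod)
    (hq : q = Polynomial.C d * (t.map fun ζ => Polynomial.X - Polynomial.C ζ).prod)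
    (h : p = q - Polynomial.X ^ m * B) (hq0 : q.eval 0 ≠ 0) :
    ∃ R : PowerSeries ℂ, invPowerSumSeries s - invPowerSumSeries t = PowerSeries.X ^ m * R ∧
      PowerSeries.constantCoeff R = m * B.eval 0 / q.eval 0 := by
  have h1 := X_mul_derivative_C_mul_prod_eq c s hs p hp
  have h2 := X_mul_derivative_C_mul_prod_eq d t ht q hq
  have hcq : PowerSeries.constantCoeff (q : PowerSeries ℂ) = q.eval 0 := by
    rw [← PowerSeries.coeff_zero_eq_constantCoeff_apply, Polynomial.coeff_coe,
      Polynomial.coeff_zero_eq_eval_zero]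
  have hcB : PowerSeries.constantCoeff (B : PowerSeries ℂ) = B.eval 0 := by
    rw [← PowerSeries.coeff_zero_eq_constantCoeff_apply, Polynomial.coeff_coe,
      Polynomial.coeff_zero_eq_eval_zero]
  have hqq : (q : PowerSeries ℂ) * (q : PowerSeries ℂ)⁻¹ = 1 :=
    PowerSeries.mul_inv_cancel _ (by rwa [hcq])
  have hder : Polynomial.X * Polynomial.derivative p = Polynomial.X * Polynomial.derivative q
      - Polynomial.X ^ m * ((m : Polynomial ℂ) * B + Polynomial.X * Polynomial.derivative B) := by
    rw [h]
    rcases m with _ | m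
    · simp; ring
    · simp; ring
  have hder' := congrArg (fun r : Polynomial ℂ => (r : PowerSeries ℂ)) hder
  have h' := congrArg (fun r : Polynomial ℂ => (r : PowerSeries ℂ)) h
  have hm : (((m : Polynomial ℂ)) : PowerSeries ℂ) = PowerSeries.C (m : ℂ) := by
    rw [← Polynomial.coe_C]; simp
  simp only [Polynomial.coe_mul, Polynomial.coe_sub, Polynomial.coe_add, Polynomial.coe_pow,
    Polynomial.coe_X, hm] at hder' h' h1 h2
  -- R comes from substituting p = q - X^m B into X p' = -p S and X q' = -q T and solving for S - T.
  refine ⟨(q : PowerSeries ℂ)⁻¹ * (PowerSeries.C (m : ℂ) * (B : PowerSeries ℂ)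
    + PowerSeries.X * ((Polynomial.derivative B : Polynomial ℂ) : PowerSeries ℂ)
    + (B : PowerSeries ℂ) * invPowerSumSeries s), ?_, ?_⟩
  · linear_combination (-(invPowerSumSeries s - invPowerSumSeries t)) * hqq
      + (q : PowerSeries ℂ)⁻¹ * (h1 - h2 - hder' - invPowerSumSeries s * h')
  · have : PowerSeries.constantCoeff (invPowerSumSeries s) = 0 := by
      rw [← PowerSeries.coeff_zero_eq_constantCoeff_apply]
      simp [invPowerSumSeries]
    simp [hcq, hcB, this, PowerSeries.constantCoeff_inv]
    ring

theorem sum_inv_pow_roots_gegenbauerCirclePoly (n : ℕ) {ρ ρ' : ℂ}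
    (hadd : ((n : ℂ) + 2) * (ρ + ρ') = 2 * (n + 5))
    (hmul : ((n : ℂ) + 1) * (n + 2) * (ρ * ρ') = (n + 4) * (n + 5)) {k : ℕ} (hk : 1 ≤ k)
    (hkn : k ≤ n + 3) :
    ((gegenbauerCirclePoly n).roots.map fun ζ => ζ⁻¹ ^ k).sum =
      ρ ^ k + ρ' ^ k - 5
        + if k = n + 3 then ((n : ℂ) + 3) * ((n + 4) * (n + 5)) / ((n + 1) * (n + 2)) else 0 := by
  have h1 : (n : ℂ) + 1 ≠ 0 := by exact_mod_cast (by omega : n + 1 ≠ 0)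
  have h2 : (n : ℂ) + 2 ≠ 0 := by exact_mod_cast (by omega : n + 2 ≠ 0)
  have h4 : (n : ℂ) + 4 ≠ 0 := by exact_mod_cast (by omega : n + 4 ≠ 0)
  have h5 : (n : ℂ) + 5 ≠ 0 := by exact_mod_cast (by omega : n + 5 ≠ 0)
  have hρρ : ρ * ρ' ≠ 0 := by
    intro h
    rw [h, mul_zero] at hmul
    exact mul_ne_zero h4 h5 hmul.symm
  have hρ : ρ ≠ 0 := left_ne_zero_of_mul hρρ
  have hρ' : ρ' ≠ 0 := right_ne_zero_of_mul hρρ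
  set P := gegenbauerCirclePoly n with hP
  have hsplit := (IsAlgClosed.splits P).eq_prod_roots
  -- The fivefold root 1 of (1-X)⁵ produces the -5, and (1-X)⁵ = -(X-1)⁵ the sign of `c`. The
  -- correction at k = n+3 is the constant term of R.
  obtain ⟨R, hR, hR0⟩ := invPowerSumSeries_sub_eq (c := -P.leadingCoeff)
    (d := ((n : ℂ) + 4) * (n + 5) / 2) (s := Multiset.replicate 5 1 + P.roots)
    (t := {ρ⁻¹, ρ'⁻¹}) (p := (1 - Polynomial.X) ^ 5 * P)
    (q := Polynomial.C (((n : ℂ) + 4) * (n + 5) / 2) *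
      ((Polynomial.X - Polynomial.C ρ⁻¹) * (Polynomial.X - Polynomial.C ρ'⁻¹)))
    (B := Polynomial.C (((n : ℂ) + 4) * (n + 5) / 2)
      - Polynomial.C (((n : ℂ) + 1) * (n + 5)) * Polynomial.X
      + Polynomial.C (((n : ℂ) + 1) * (n + 2) / 2) * Polynomial.X ^ 2) (m := n + 3)
    (by
      intro ζ hζ
      rcases Multiset.mem_add.1 hζ with h | h
      · rw [Multiset.eq_of_mem_replicate h]; exact one_ne_zero
      · rintro rfl
        exact gegenbauerCirclePoly_eval_zero_ne n (Polynomial.isRoot_of_mem_roots h))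
    (by simp [hρ, hρ'])
    (by
      rw [Multiset.map_add, Multiset.prod_add, Multiset.map_replicate, Multiset.prod_replicate]
      nth_rw 1 [hsplit]
      simp only [map_neg, map_one]
      ring)
    (by simp)
    (by
      refine Polynomial.funext fun w => ?_
      simp only [Polynomial.eval_mul, Polynomial.eval_sub, Polynomial.eval_add,
        Polynomial.eval_C, Polynomial.eval_X, Polynomial.eval_one, Polynomial.eval_pow]
      rw [one_sub_pow_five_mul_gegenbauerCirclePoly_eval]
      have e1 : ((n : ℂ) + 4) * (n + 5) * (ρ⁻¹ * ρ'⁻¹) = (n + 1) * (n + 2) := by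
        rw [← hmul]; field_simp
      have e2 : ((n : ℂ) + 4) * (n + 5) * (ρ⁻¹ + ρ'⁻¹) = 2 * (n + 1) * (n + 5) := by
        have : ((n : ℂ) + 4) * (n + 5) * (ρ⁻¹ + ρ'⁻¹) = (n + 1) * ((n + 2) * (ρ + ρ')) := by
          rw [← hmul]; field_simp; ring
        rw [this, hadd]; ring
      linear_combination -e1 / 2 + w * e2 / 2)
    (by simp [hρ, hρ', h4, h5])
  have hc := congrArg (PowerSeries.coeff k) hR
  have hk0 : k ≠ 0 := by omega
  rw [PowerSeries.coeff_X_pow_mul'] at hc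
  simp [invPowerSumSeries, hk0] at hc
  have hQ : (((n : ℂ) + 4) * (n + 5) / 2) * (ρ⁻¹ * ρ'⁻¹) = (n + 1) * (n + 2) / 2 := by
    rw [← hmul]; field_simp
  rcases Nat.lt_or_eq_of_le hkn with hlt | rfl
  · rw [if_neg (by omega)] at hc
    rw [if_neg (by omega)]
    simp
    linear_combination hc
  · simp at hR0 hc
    rw [hR0, hQ] at hc
    simp
    have e : ((n : ℂ) + 3) * ((n + 4) * (n + 5) / 2) / ((n + 1) * (n + 2) / 2) =
        (n + 3) * ((n + 4) * (n + 5)) / ((n + 1) * (n + 2)) := by field_simp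
    rw [e] at hc
    linear_combination hc

/-! ### Cosine coefficients of log|e^{iφ} - ζ| for |ζ| = 1. -/

theorem integral_exp_int_mul_I (j : ℤ) :
    ∫ φ in (0 : ℝ)..2 * Real.pi, Complex.exp (j * φ * Complex.I) =
      if j = 0 then 2 * Real.pi else 0 := by
  split_ifs with h
  · simp [h]
  · have hj : (j : ℂ) * Complex.I ≠ 0 := by simp [h]
    have e : ∀ φ : ℝ, Complex.exp (j * φ * Complex.I) = Complex.exp ((j : ℂ) * Complex.I * φ) :=
      fun φ => by ring_nf
    simp_rw [e]
    rw [integral_exp_mul_complex hj]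
    have : (j : ℂ) * Complex.I * ((2 * Real.pi : ℝ) : ℂ) = j * (2 * Real.pi * Complex.I) := by
      push_cast; ring
    rw [this, Complex.exp_int_mul_two_pi_mul_I]
    simp

theorem integral_exp_pow_mul_cos (m : ℕ) {k : ℕ} (hk : 1 ≤ k) :
    ∫ φ in (0 : ℝ)..2 * Real.pi, Complex.exp (φ * Complex.I) ^ m * Complex.cos (k * φ) =
      if m = k then (Real.pi : ℂ) else 0 := by
  have e : ∀ φ : ℝ, Complex.exp (φ * Complex.I) ^ m * Complex.cos (k * φ) =
      (1 / 2) * Complex.exp ((m + k : ℤ) * φ * Complex.I)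
        + (1 / 2) * Complex.exp ((m - k : ℤ) * φ * Complex.I) := by
    intro φ
    rw [← Complex.exp_nat_mul, Complex.cos]
    have e1 : Complex.exp ((m + k : ℤ) * φ * Complex.I) =
        Complex.exp (m * (φ * Complex.I)) * Complex.exp (k * φ * Complex.I) := by
      rw [← Complex.exp_add]; congr 1; push_cast; ring
    have e2 : Complex.exp ((m - k : ℤ) * φ * Complex.I) =
        Complex.exp (m * (φ * Complex.I)) * Complex.exp (-(k * φ) * Complex.I) := by
      rw [← Complex.exp_add]; congr 1; push_cast; ring
    rw [e1, e2]; ring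
  simp_rw [e]
  rw [intervalIntegral.integral_add, intervalIntegral.integral_const_mul,
    intervalIntegral.integral_const_mul, integral_exp_int_mul_I, integral_exp_int_mul_I,
    if_neg (by omega)]
  · by_cases h : m = k
    · simp [h]
    · rw [if_neg (by omega), if_neg h]; simp
  · exact Continuous.intervalIntegrable (by fun_prop) _ _
  · exact Continuous.intervalIntegrable (by fun_prop) _ _

/-- Inside the disc the Taylor series of -log(1 - u e^{iφ}) is integrated term by term, and only the
term m = k survives. -/
theorem integral_log_norm_one_sub_mul_exp_mul_cos {u : ℂ} (hu : ‖u‖ < 1) {k : ℕ} (hk : 1 ≤ k) :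
    ∫ φ in (0 : ℝ)..2 * Real.pi,
        Real.log ‖1 - u * Complex.exp (φ * Complex.I)‖ * Real.cos (k * φ) =
      -(Real.pi / k) * (u ^ k).re := by
  have hn : ∀ φ : ℝ, ‖u * Complex.exp (φ * Complex.I)‖ = ‖u‖ := fun φ => by
    rw [norm_mul, Complex.norm_exp_ofReal_mul_I, mul_one]
  have hslit : ∀ φ : ℝ, 1 - u * Complex.exp (φ * Complex.I) ∈ Complex.slitPlane := by
    intro φ
    rw [sub_eq_add_neg]
    exact Complex.mem_slitPlane_of_norm_lt_one (by rw [norm_neg, hn]; exact hu)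
  have hsum := intervalIntegral.hasSum_integral_of_dominated_convergence
    (μ := MeasureTheory.volume) (a := 0) (b := 2 * Real.pi)
    (F := fun (m : ℕ) (φ : ℝ) =>
      (u * Complex.exp (φ * Complex.I)) ^ m / m * Complex.cos (k * φ))
    (f := fun φ : ℝ => -Complex.log (1 - u * Complex.exp (φ * Complex.I)) * Complex.cos (k * φ))
    (fun m _ => ‖u‖ ^ m)
    (fun m => (Continuous.aestronglyMeasurable (by fun_prop)))
    (fun m => Filter.Eventually.of_forall fun φ _ => by
      rw [norm_mul, norm_div, norm_pow, hn]
      have h1 : ‖Complex.cos (k * φ)‖ ≤ 1 := by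
        have : Complex.cos (k * φ) = ((Real.cos (k * φ) : ℝ) : ℂ) := by push_cast; rfl
        rw [this, Complex.norm_real]
        exact Real.abs_cos_le_one _
      have h2 : ‖u‖ ^ m / ‖(m : ℂ)‖ ≤ ‖u‖ ^ m := by
        rw [Complex.norm_natCast]
        -- For m = 0 the term is a division by 0, hence 0, as the series has no constant term.
        rcases Nat.eq_zero_or_pos m with h | h
        · simp [h]
        · exact div_le_self (by positivity) (by exact_mod_cast h)
      calc _ ≤ ‖u‖ ^ m * 1 := by gcongr
        _ = _ := mul_one _)
    (Filter.Eventually.of_forall fun φ _ => summable_geometric_of_lt_one (norm_nonneg u) hu)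
    (by simp)
    (Filter.Eventually.of_forall fun φ _ =>
      (Complex.hasSum_taylorSeries_neg_log (by rw [hn]; exact hu)).mul_right _)
  have hterm : ∀ m : ℕ, ∫ φ in (0 : ℝ)..2 * Real.pi,
      (u * Complex.exp (φ * Complex.I)) ^ m / m * Complex.cos (k * φ) =
      if m = k then u ^ k / k * Real.pi else 0 := by
    intro m
    have e : ∀ φ : ℝ, (u * Complex.exp (φ * Complex.I)) ^ m / m * Complex.cos (k * φ) =
        u ^ m / m * (Complex.exp (φ * Complex.I) ^ m * Complex.cos (k * φ)) := by
      intro φ; rw [mul_pow]; ring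
    simp_rw [e]
    rw [intervalIntegral.integral_const_mul, integral_exp_pow_mul_cos m hk]
    split_ifs with h
    · rw [h]
    · simp
  simp_rw [hterm] at hsum
  have hval := hsum.unique (hasSum_ite_eq k _)
  have hcont : Continuous fun φ : ℝ =>
      -Complex.log (1 - u * Complex.exp (φ * Complex.I)) * Complex.cos (k * φ) :=
    (Continuous.clog (by fun_prop) hslit).neg.mul (by fun_prop)
  have hre := Complex.reCLM.intervalIntegral_comp_comm
    (hcont.intervalIntegrable (μ := MeasureTheory.volume) 0 (2 * Real.pi))
  rw [hval] at hre
  have e : ∀ φ : ℝ, Complex.reCLM (-Complex.log (1 - u * Complex.exp (φ * Complex.I))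
      * Complex.cos (k * φ)) =
      -(Real.log ‖1 - u * Complex.exp (φ * Complex.I)‖ * Real.cos (k * φ)) := by
    intro φ
    have : Complex.cos (k * φ) = ((Real.cos (k * φ) : ℝ) : ℂ) := by push_cast; rfl
    rw [this, Complex.reCLM_apply, Complex.re_mul_ofReal, Complex.neg_re, Complex.log_re]
    ring
  simp_rw [e] at hre
  rw [intervalIntegral.integral_neg, Complex.reCLM_apply, Complex.re_mul_ofReal,
    Complex.div_natCast_re] at hre
  linear_combination -hre

theorem norm_one_sub_le_two_mul {v : ℂ} (hv : ‖v‖ = 1) {r : ℝ} (h0 : 0 ≤ r) (h1 : r ≤ 1) :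
    ‖1 - v‖ ≤ 2 * ‖1 - r * v‖ := by
  have e : 1 - v = (1 - r * v) + (-(1 - r : ℝ)) * v := by push_cast; ring
  have hr : ‖(r : ℂ) * v‖ = r := by
    rw [norm_mul, hv, Complex.norm_real, mul_one]
    exact abs_of_nonneg h0
  have h2 : 1 - r ≤ ‖1 - r * v‖ := by
    have := norm_sub_norm_le 1 ((r : ℂ) * v)
    rwa [hr, norm_one] at this
  have h3 : ‖(-(1 - r : ℝ) : ℂ) * v‖ = 1 - r := by
    rw [norm_mul, norm_neg, hv, mul_one, Complex.norm_real]
    exact abs_of_nonneg (by linarith)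
  calc ‖1 - v‖ ≤ ‖1 - r * v‖ + ‖(-(1 - r : ℝ) : ℂ) * v‖ := by
        conv_lhs => rw [e]
        exact norm_add_le _ _
    _ ≤ _ := by rw [h3]; linarith

/-- The bound does not depend on r, so it dominates the integrands as r → 1⁻. -/
theorem abs_log_norm_one_sub_le {v : ℂ} (hv : ‖v‖ = 1) (hv1 : v ≠ 1) {r : ℝ} (h0 : 0 ≤ r)
    (h1 : r ≤ 1) : |Real.log ‖1 - r * v‖| ≤ Real.log 2 + |Real.log ‖1 - v‖| := by
  have hpos : 0 < ‖1 - v‖ := norm_pos_iff.2 (sub_ne_zero.2 hv1.symm)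
  have hle := norm_one_sub_le_two_mul hv h0 h1
  have hpos' : 0 < ‖1 - r * v‖ := by linarith
  have hup : ‖1 - r * v‖ ≤ 2 := by
    have := norm_sub_le 1 ((r : ℂ) * v)
    rw [norm_mul, hv, Complex.norm_real, norm_one, mul_one, Real.norm_eq_abs,
      abs_of_nonneg h0] at this
    linarith
  have l1 := Real.log_le_log hpos hle
  rw [Real.log_mul two_ne_zero hpos'.ne'] at l1
  have l2 := Real.log_le_log hpos' hup
  have l3 := neg_abs_le (Real.log ‖1 - v‖)
  have l4 := abs_nonneg (Real.log ‖1 - v‖)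
  exact abs_le.2 ⟨by linarith, by linarith⟩

theorem countable_setOf_exp_mul_I_eq (ζ : ℂ) :
    {φ : ℝ | Complex.exp (φ * Complex.I) = ζ}.Countable := by
  rcases Set.eq_empty_or_nonempty {φ : ℝ | Complex.exp (φ * Complex.I) = ζ} with h | ⟨η, hη⟩
  · rw [h]; exact Set.countable_empty
  · refine (Set.countable_range fun j : ℤ => η + j * (2 * Real.pi)).mono ?_
    intro φ hφ
    have : Complex.exp (φ * Complex.I) = Complex.exp (η * Complex.I) := hφ.trans hη.symm
    obtain ⟨j, hj⟩ := Complex.exp_eq_exp_iff_exists_int.1 this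
    refine ⟨j, ?_⟩
    have hj' : ((φ : ℂ)) * Complex.I = ((η + j * (2 * Real.pi) : ℝ) : ℂ) * Complex.I := by
      rw [hj]; push_cast; ring
    exact_mod_cast (mul_right_cancel₀ Complex.I_ne_zero hj').symm

theorem intervalIntegrable_log_norm_exp_sub (ζ : ℂ) :
    IntervalIntegrable (fun φ : ℝ => Real.log ‖Complex.exp (φ * Complex.I) - ζ‖)
      MeasureTheory.volume 0 (2 * Real.pi) := by
  have := circleIntegrable_log_norm_sub_const (a := ζ) (c := 0) 1
  simpa [CircleIntegrable, circleMap] using this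

theorem integral_log_norm_exp_sub {ζ : ℂ} (hζ : ‖ζ‖ = 1) :
    ∫ φ in (0 : ℝ)..2 * Real.pi, Real.log ‖Complex.exp (φ * Complex.I) - ζ‖ = 0 := by
  have := circleAverage_log_norm_sub_const₁ hζ
  simpa [Real.circleAverage, circleMap, Real.pi_ne_zero] using this

/-- Radial limit of the disc case: ζ⁻¹ is replaced by r ζ⁻¹ and r → 1⁻ under dominated convergence.
-/
theorem integral_log_norm_exp_sub_mul_cos {ζ : ℂ} (hζ : ‖ζ‖ = 1) {k : ℕ} (hk : 1 ≤ k) :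
    ∫ φ in (0 : ℝ)..2 * Real.pi,
        Real.log ‖Complex.exp (φ * Complex.I) - ζ‖ * Real.cos (k * φ) =
      -(Real.pi / k) * (ζ⁻¹ ^ k).re := by
  have hζ0 : ζ ≠ 0 := by rintro rfl; simp at hζ
  have hv : ∀ φ : ℝ, ‖ζ⁻¹ * Complex.exp (φ * Complex.I)‖ = 1 := fun φ => by
    rw [norm_mul, norm_inv, hζ, Complex.norm_exp_ofReal_mul_I]; simp
  have hnorm : ∀ φ : ℝ, ‖Complex.exp (φ * Complex.I) - ζ‖ =
      ‖1 - ζ⁻¹ * Complex.exp (φ * Complex.I)‖ := by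
    intro φ
    have : Complex.exp (φ * Complex.I) - ζ = -ζ * (1 - ζ⁻¹ * Complex.exp (φ * Complex.I)) := by
      field_simp; ring
    rw [this, norm_mul, norm_neg, hζ, one_mul]
  have hae : ∀ᵐ φ : ℝ, ζ⁻¹ * Complex.exp (φ * Complex.I) ≠ 1 := by
    filter_upwards [(countable_setOf_exp_mul_I_eq ζ).ae_notMem MeasureTheory.volume] with φ hφ h
    exact hφ ((inv_mul_eq_one₀ hζ0).1 h).symm
  have hint := intervalIntegrable_log_norm_exp_sub ζ
  simp_rw [hnorm] at hint ⊢
  have hIoo : ∀ᶠ r : ℝ in 𝓝[<] 1, r ∈ Set.Ioo (0 : ℝ) 1 :=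
    Ioo_mem_nhdsLT one_pos
  have hlim := intervalIntegral.tendsto_integral_filter_of_dominated_convergence
    (μ := MeasureTheory.volume) (a := 0) (b := 2 * Real.pi) (l := 𝓝[<] (1 : ℝ))
    (F := fun (r : ℝ) (φ : ℝ) =>
      Real.log ‖1 - (r * ζ⁻¹) * Complex.exp (φ * Complex.I)‖ * Real.cos (k * φ))
    (f := fun φ : ℝ => Real.log ‖1 - ζ⁻¹ * Complex.exp (φ * Complex.I)‖ * Real.cos (k * φ))
    (fun φ => Real.log 2 + |Real.log ‖1 - ζ⁻¹ * Complex.exp (φ * Complex.I)‖|)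
    (Filter.Eventually.of_forall fun r => by
      refine Measurable.aestronglyMeasurable ?_
      fun_prop)
    (by
      filter_upwards [hIoo] with r hr
      filter_upwards [hae] with φ hφ _
      rw [norm_mul]
      calc _ ≤ (Real.log 2 + |Real.log ‖1 - ζ⁻¹ * Complex.exp (φ * Complex.I)‖|) * 1 := by
            gcongr
            · rw [mul_assoc]
              exact abs_log_norm_one_sub_le (hv φ) hφ hr.1.le hr.2.le
            · exact Real.abs_cos_le_one _
        _ = _ := mul_one _)
    (intervalIntegrable_const.add hint.abs)
    (by
      filter_upwards [hae] with φ hφ _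
      refine Filter.Tendsto.mul_const _ ?_
      have hc : ContinuousAt (fun r : ℝ =>
          Real.log ‖1 - (r * ζ⁻¹) * Complex.exp (φ * Complex.I)‖) 1 := by
        refine ContinuousAt.log (by fun_prop) ?_
        rw [norm_ne_zero_iff, sub_ne_zero]
        simpa using hφ.symm
      have := hc.tendsto.mono_left (nhdsWithin_le_nhds (s := Set.Iio 1))
      simpa using this)
  have hlim' : Filter.Tendsto (fun r : ℝ => -(Real.pi / k) * (((r : ℂ) * ζ⁻¹) ^ k).re)
      (𝓝[<] 1) (𝓝 (-(Real.pi / k) * (ζ⁻¹ ^ k).re)) := by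
    have hc : ContinuousAt (fun r : ℝ => -(Real.pi / k) * (((r : ℂ) * ζ⁻¹) ^ k).re) 1 := by
      fun_prop
    have := hc.tendsto.mono_left (nhdsWithin_le_nhds (s := Set.Iio 1))
    simpa using this
  refine tendsto_nhds_unique (hlim.congr' ?_) hlim'
  filter_upwards [hIoo] with r hr
  refine integral_log_norm_one_sub_mul_exp_mul_cos ?_ hk
  rw [norm_mul, norm_inv, hζ, Complex.norm_real, Real.norm_eq_abs, abs_of_pos hr.1]
  simpa using hr.2

/-! ### Fourier expansion of 64 C_n² sin⁶θ. -/

theorem one_sub_pow_four_mul_sum_cubic (c w : ℂ) (M : ℕ) :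
    (1 - w) ^ 4 * ∑ k ∈ Finset.range M,
        (6 * ((k : ℂ) + 1) ^ 3 - c * (k + 1)) * w ^ (k + 1) =
      6 * (w + 4 * w ^ 2 + w ^ 3) - c * w * (1 - w) ^ 2
        - w ^ (M + 1) * (6 * (((M : ℂ) + 1) ^ 3 + (4 - 6 * M ^ 2 - 3 * M ^ 3) * w
            + (1 - 3 * M + 3 * M ^ 2 + 3 * M ^ 3) * w ^ 2 - M ^ 3 * w ^ 3)
          - c * (1 - w) ^ 2 * ((M + 1) - M * w)) := by
  induction M with
  | zero => simp; ring
  | succ M ih =>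
    rw [Finset.sum_range_succ, mul_add, ih]
    push_cast
    ring

theorem gegenbauerCirclePoly_sq_expansion (n : ℕ) {w : ℂ} (h0 : w ≠ 0) (h1 : w ≠ 1) :
    -((1 - w) ^ 6 * (gegenbauerCirclePoly n).eval w ^ 2) =
      w ^ (n + 3) * (((n : ℂ) + 1) * (n + 2) * (n + 4) * (n + 5) / 2
        + ∑ k ∈ Finset.range (n + 2),
          (6 * ((k : ℂ) + 1) ^ 3 - 3 * ((n : ℂ) ^ 2 + 6 * n + 7) * (k + 1))
            * (w ^ (k + 1) + w⁻¹ ^ (k + 1))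
        - ((n + 1) * (n + 2) / 2) ^ 2 * (w ^ (n + 3) + w⁻¹ ^ (n + 3))) := by
  -- The factor (1-w)⁴ completes (1-w)⁶ P_n² to the square of (1-w)⁵ P_n and also clears the sums of
  -- cubics in w and in w⁻¹.
  have hw : (1 - w) ^ 4 ≠ 0 := pow_ne_zero 4 (sub_ne_zero.2 h1.symm)
  refine mul_left_cancel₀ hw ?_
  have hN := one_sub_pow_five_mul_gegenbauerCirclePoly_eval n w
  have s1 := one_sub_pow_four_mul_sum_cubic (3 * ((n : ℂ) ^ 2 + 6 * n + 7)) w (n + 2)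
  have s2 := one_sub_pow_four_mul_sum_cubic (3 * ((n : ℂ) ^ 2 + 6 * n + 7)) w⁻¹ (n + 2)
  have e4 : (1 - w) ^ 4 = w ^ 4 * (1 - w⁻¹) ^ 4 := by
    rw [← mul_pow, mul_sub, mul_one, mul_inv_cancel₀ h0, ← neg_sub, neg_pow]; norm_num
  have hsplit : ∑ k ∈ Finset.range (n + 2),
      (6 * ((k : ℂ) + 1) ^ 3 - 3 * ((n : ℂ) ^ 2 + 6 * n + 7) * (k + 1))
        * (w ^ (k + 1) + w⁻¹ ^ (k + 1)) =
      ∑ k ∈ Finset.range (n + 2),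
        (6 * ((k : ℂ) + 1) ^ 3 - 3 * ((n : ℂ) ^ 2 + 6 * n + 7) * (k + 1)) * w ^ (k + 1)
      + ∑ k ∈ Finset.range (n + 2),
        (6 * ((k : ℂ) + 1) ^ 3 - 3 * ((n : ℂ) ^ 2 + 6 * n + 7) * (k + 1)) * w⁻¹ ^ (k + 1) := by
    rw [← Finset.sum_add_distrib]
    exact Finset.sum_congr rfl fun _ _ => mul_add _ _ _
  rw [hsplit]
  set S₁ := ∑ k ∈ Finset.range (n + 2),
    (6 * ((k : ℂ) + 1) ^ 3 - 3 * ((n : ℂ) ^ 2 + 6 * n + 7) * (k + 1)) * w ^ (k + 1)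
  set S₂ := ∑ k ∈ Finset.range (n + 2),
    (6 * ((k : ℂ) + 1) ^ 3 - 3 * ((n : ℂ) ^ 2 + 6 * n + 7) * (k + 1)) * w⁻¹ ^ (k + 1)
  have s2' : (1 - w) ^ 4 * S₂ = w ^ 4 * ((1 - w⁻¹) ^ 4 * S₂) := by rw [e4]; ring
  rw [s2] at s2'
  have l : (1 - w) ^ 4 * -((1 - w) ^ 6 * (gegenbauerCirclePoly n).eval w ^ 2) =
      -((1 - w) ^ 5 * (gegenbauerCirclePoly n).eval w) ^ 2 := by ring
  have r : ∀ A B : ℂ, (1 - w) ^ 4 * (w ^ (n + 3) * (A + (S₁ + S₂) - B)) =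
      w ^ (n + 3) * ((1 - w) ^ 4 * A + (1 - w) ^ 4 * S₁ + (1 - w) ^ 4 * S₂
        - (1 - w) ^ 4 * B) := by intros; ring
  rw [l, hN, r, s1, s2']
  push_cast
  simp only [inv_pow]
  field_simp
  ring

/-- The trigonometric polynomial `64 * C_n^{(3)}(cos θ)² * sin θ ^ 6` as a function of `φ = 2θ`. -/
noncomputable def gegenbauerTrigPoly (n : ℕ) (φ : ℝ) : ℝ :=
  ((n : ℝ) + 1) * (n + 2) * (n + 4) * (n + 5) / 2
    + ∑ k ∈ Finset.range (n + 2),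
      (6 * ((k : ℝ) + 1) ^ 3 - 3 * ((n : ℝ) ^ 2 + 6 * n + 7) * (k + 1))
        * (2 * Real.cos ((k + 1 : ℕ) * φ))
    - ((n + 1) * (n + 2) / 2) ^ 2 * (2 * Real.cos ((n + 3 : ℕ) * φ))

theorem exp_mul_I_pow_add_inv_pow (φ : ℝ) (k : ℕ) :
    Complex.exp (φ * Complex.I) ^ k + (Complex.exp (φ * Complex.I))⁻¹ ^ k =
      ((2 * Real.cos (k * φ) : ℝ) : ℂ) := by
  rw [← Complex.exp_neg, ← Complex.exp_nat_mul, ← Complex.exp_nat_mul]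
  push_cast
  rw [Complex.two_cos]
  ring_nf

/-- Since 1 - z² = -2iz sin θ, the quantity -(1-w)⁶ P_n(w)² equals 64 w^{n+3} C_n² sin⁶θ. The
hypothesis sin θ ≠ 0 means w ≠ 1. -/
theorem gegenbauerC_three_sq_mul_sin_pow (n : ℕ) {θ : ℝ} (hθ : Real.sin θ ≠ 0) :
    64 * (gegenbauerC n 3 (Real.cos θ) ^ 2 * Real.sin θ ^ 6) = gegenbauerTrigPoly n (2 * θ) := by
  set z := Complex.exp (θ * Complex.I) with hz
  have hz0 : z ≠ 0 := Complex.exp_ne_zero _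
  have hzcs : z = Real.cos θ + Real.sin θ * Complex.I := by
    rw [hz, Complex.exp_mul_I]; push_cast; rfl
  have hcs : (Real.cos θ : ℂ) ^ 2 + (Real.sin θ : ℂ) ^ 2 = 1 := by
    exact_mod_cast Real.cos_sq_add_sin_sq θ
  have hI := Complex.I_sq
  have hw : Complex.exp (((2 * θ : ℝ) : ℂ) * Complex.I) = z ^ 2 := by
    rw [hz, ← Complex.exp_nat_mul]; push_cast; ring_nf
  have hquad : z ^ 2 + 1 = 2 * (Real.cos θ : ℝ) * z := by
    rw [hzcs]
    linear_combination (Real.sin θ : ℂ) ^ 2 * hI - hcs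
  have hsub : 1 - z ^ 2 = -2 * Complex.I * z * Real.sin θ := by
    rw [hzcs]
    linear_combination (2 * Real.sin θ ^ 2 - (Real.sin θ : ℂ) ^ 2) * hI - hcs
  have hne : z ^ 2 ≠ 1 := by
    intro h
    rw [h, sub_self] at hsub
    have : (Real.sin θ : ℂ) ≠ 0 := by exact_mod_cast hθ
    exact mul_ne_zero (mul_ne_zero (mul_ne_zero (by norm_num) Complex.I_ne_zero) hz0) this hsub.symm
  have hexp := gegenbauerCirclePoly_sq_expansion n (pow_ne_zero 2 hz0) hne
  rw [← gegenbauerC_three_eq_eval n (Real.cos θ) z hquad, hsub] at hexp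
  have hI6 : Complex.I ^ 6 = -1 := by
    rw [show 6 = 2 * 3 by norm_num, pow_mul, hI]; norm_num
  have hl : -((-2 * Complex.I * z * Real.sin θ) ^ 6
      * (z ^ n * (gegenbauerC n 3 (Real.cos θ) : ℂ)) ^ 2) =
      (z ^ 2) ^ (n + 3) * (64 * ((gegenbauerC n 3 (Real.cos θ) : ℂ) ^ 2
        * (Real.sin θ : ℂ) ^ 6)) := by
    linear_combination (-64 * z ^ 6 * (Real.sin θ : ℂ) ^ 6 * z ^ (2 * n)
      * (gegenbauerC n 3 (Real.cos θ) : ℂ) ^ 2) * hI6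
  rw [hl] at hexp
  have hexp := mul_left_cancel₀ (pow_ne_zero (n + 3) (pow_ne_zero 2 hz0)) hexp
  rw [← hw] at hexp
  simp only [exp_mul_I_pow_add_inv_pow] at hexp
  apply Complex.ofReal_injective
  rw [gegenbauerTrigPoly]
  push_cast at hexp ⊢
  exact hexp

/-! ### Fourier coefficients of log|P_n| and the pairing. -/

theorem intervalIntegrable_sum_log_norm_exp_sub (s : Multiset ℂ) :
    IntervalIntegrable
      (fun φ : ℝ => (s.map fun ζ => Real.log ‖Complex.exp (φ * Complex.I) - ζ‖).sum)
      MeasureTheory.volume 0 (2 * Real.pi) := by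
  induction s using Multiset.induction_on with
  | empty => simp
  | cons ζ s ih =>
    simp only [Multiset.map_cons, Multiset.sum_cons]
    exact (intervalIntegrable_log_norm_exp_sub ζ).add ih

theorem integral_sum_log_norm_exp_sub (s : Multiset ℂ) (hs : ∀ ζ ∈ s, ‖ζ‖ = 1) :
    ∫ φ in (0 : ℝ)..2 * Real.pi,
      (s.map fun ζ => Real.log ‖Complex.exp (φ * Complex.I) - ζ‖).sum = 0 := by
  induction s using Multiset.induction_on with
  | empty => simp
  | cons ζ s ih =>
    simp only [Multiset.map_cons, Multiset.sum_cons]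
    rw [intervalIntegral.integral_add (intervalIntegrable_log_norm_exp_sub ζ)
      (intervalIntegrable_sum_log_norm_exp_sub s),
      integral_log_norm_exp_sub (hs ζ (Multiset.mem_cons_self ζ s)),
      ih fun ξ hξ => hs ξ (Multiset.mem_cons_of_mem hξ), add_zero]

theorem integral_sum_log_norm_exp_sub_mul_cos (s : Multiset ℂ) (hs : ∀ ζ ∈ s, ‖ζ‖ = 1) {k : ℕ}
    (hk : 1 ≤ k) :
    ∫ φ in (0 : ℝ)..2 * Real.pi,
      (s.map fun ζ => Real.log ‖Complex.exp (φ * Complex.I) - ζ‖).sum * Real.cos (k * φ) =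
      -(Real.pi / k) * (s.map fun ζ => ζ⁻¹ ^ k).sum.re := by
  have hcos : Continuous fun φ : ℝ => Real.cos (k * φ) := by fun_prop
  induction s using Multiset.induction_on with
  | empty => simp
  | cons ζ s ih =>
    simp only [Multiset.map_cons, Multiset.sum_cons, add_mul, Complex.add_re]
    rw [intervalIntegral.integral_add
      ((intervalIntegrable_log_norm_exp_sub ζ).mul_continuousOn hcos.continuousOn)
      ((intervalIntegrable_sum_log_norm_exp_sub s).mul_continuousOn hcos.continuousOn),
      integral_log_norm_exp_sub_mul_cos (hs ζ (Multiset.mem_cons_self ζ s)) hk,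
      ih fun ξ hξ => hs ξ (Multiset.mem_cons_of_mem hξ)]
    ring

theorem norm_of_mem_roots_gegenbauerCirclePoly {n : ℕ} {ζ : ℂ}
    (h : ζ ∈ (gegenbauerCirclePoly n).roots) : ‖ζ‖ = 1 :=
  norm_eq_one_of_gegenbauerCirclePoly_root (Polynomial.isRoot_of_mem_roots h)

/-- The roots are unimodular, so the leading coefficient has the same modulus as P_n(0). -/
theorem norm_eval_gegenbauerCirclePoly (n : ℕ) (w : ℂ) :
    ‖(gegenbauerCirclePoly n).eval w‖ = ((n : ℝ) + 1) * (n + 2) / 2 *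
      ((gegenbauerCirclePoly n).roots.map fun ζ => ‖w - ζ‖).prod := by
  have hev : ∀ v : ℂ, ‖(gegenbauerCirclePoly n).eval v‖ =
      ‖(gegenbauerCirclePoly n).leadingCoeff‖ *
        ((gegenbauerCirclePoly n).roots.map fun ζ => ‖v - ζ‖).prod := by
    intro v
    rw [(IsAlgClosed.splits (gegenbauerCirclePoly n)).eval_eq_prod_roots, norm_mul]
    congr 1
    induction (gegenbauerCirclePoly n).roots using Multiset.induction_on with
    | empty => simp
    | cons ζ s ih => simp only [Multiset.map_cons, Multiset.prod_cons, norm_mul, ih]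
  have h0 := hev 0
  have h1 : ((gegenbauerCirclePoly n).roots.map fun ζ => ‖0 - ζ‖).prod = 1 := by
    refine Multiset.prod_eq_one fun x hx => ?_
    obtain ⟨ζ, hζ, rfl⟩ := Multiset.mem_map.1 hx
    rw [zero_sub, norm_neg, norm_of_mem_roots_gegenbauerCirclePoly hζ]
  rw [h1, mul_one, gegenbauerCirclePoly_eval_zero] at h0
  rw [hev, ← h0]
  congr 1
  have : ((n : ℂ) + 1) * (n + 2) / 2 = ((((n : ℝ) + 1) * (n + 2) / 2 : ℝ) : ℂ) := by push_cast; rfl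
  rw [this, Complex.norm_real, Real.norm_eq_abs, abs_of_pos (by positivity)]

theorem log_prod_norm_sub (w : ℂ) (s : Multiset ℂ) (hs : w ∉ s) :
    Real.log (s.map fun ζ => ‖w - ζ‖).prod = (s.map fun ζ => Real.log ‖w - ζ‖).sum := by
  induction s using Multiset.induction_on with
  | empty => simp
  | cons ζ s ih =>
    rw [Multiset.mem_cons, not_or] at hs
    simp only [Multiset.map_cons, Multiset.prod_cons, Multiset.sum_cons]
    rw [Real.log_mul (norm_ne_zero_iff.2 (sub_ne_zero.2 hs.1)), ih hs.2]
    intro h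
    obtain ⟨ξ, hξ, h0⟩ := Multiset.mem_map.1 (Multiset.prod_eq_zero_iff.1 h)
    rw [norm_eq_zero, sub_eq_zero] at h0
    exact hs.2 (h0 ▸ hξ)

/-- The angles of zeros, where the logarithm of the product does not split, form a countable set. -/
theorem log_norm_eval_gegenbauerCirclePoly_ae (n : ℕ) :
    ∀ᵐ φ : ℝ, Real.log ‖(gegenbauerCirclePoly n).eval (Complex.exp (φ * Complex.I))‖ =
      Real.log (((n : ℝ) + 1) * (n + 2) / 2) + ((gegenbauerCirclePoly n).roots.map
        fun ζ => Real.log ‖Complex.exp (φ * Complex.I) - ζ‖).sum := by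
  have hc : {φ : ℝ | Complex.exp (φ * Complex.I) ∈ (gegenbauerCirclePoly n).roots}.Countable := by
    have : {φ : ℝ | Complex.exp (φ * Complex.I) ∈ (gegenbauerCirclePoly n).roots} =
        ⋃ ζ ∈ (gegenbauerCirclePoly n).roots.toFinset,
          {φ : ℝ | Complex.exp (φ * Complex.I) = ζ} := by
      ext φ; simp
    rw [this]
    exact (Finset.countable_toSet _).biUnion fun ζ _ => countable_setOf_exp_mul_I_eq ζ
  filter_upwards [hc.ae_notMem MeasureTheory.volume] with φ hφ
  have hφ' : Complex.exp (φ * Complex.I) ∉ (gegenbauerCirclePoly n).roots := hφ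
  rw [norm_eval_gegenbauerCirclePoly, Real.log_mul (by positivity), log_prod_norm_sub _ _ hφ']
  intro h
  rw [Multiset.prod_eq_zero_iff] at h
  obtain ⟨ζ, hζ, h0⟩ := Multiset.mem_map.1 h
  rw [norm_eq_zero, sub_eq_zero] at h0
  exact hφ' (h0 ▸ hζ)

theorem intervalIntegrable_log_norm_gegenbauerCirclePoly (n : ℕ) :
    IntervalIntegrable (fun φ : ℝ =>
      Real.log ‖(gegenbauerCirclePoly n).eval (Complex.exp (φ * Complex.I))‖)
      MeasureTheory.volume 0 (2 * Real.pi) := by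
  refine ((intervalIntegrable_const (c := Real.log (((n : ℝ) + 1) * (n + 2) / 2))).add
    (intervalIntegrable_sum_log_norm_exp_sub (gegenbauerCirclePoly n).roots)).congr_ae ?_
  exact MeasureTheory.ae_restrict_of_ae ((log_norm_eval_gegenbauerCirclePoly_ae n).mono
    fun φ h => h.symm)

theorem integral_log_norm_gegenbauerCirclePoly (n : ℕ) :
    ∫ φ in (0 : ℝ)..2 * Real.pi,
      Real.log ‖(gegenbauerCirclePoly n).eval (Complex.exp (φ * Complex.I))‖ =
      2 * Real.pi * Real.log (((n : ℝ) + 1) * (n + 2) / 2) := by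
  rw [intervalIntegral.integral_congr_ae
    ((log_norm_eval_gegenbauerCirclePoly_ae n).mono fun φ h _ => h),
    intervalIntegral.integral_add intervalIntegrable_const
      (intervalIntegrable_sum_log_norm_exp_sub _),
    integral_sum_log_norm_exp_sub _ fun ζ => norm_of_mem_roots_gegenbauerCirclePoly]
  simp

theorem integral_log_norm_gegenbauerCirclePoly_mul_cos (n : ℕ) {k : ℕ} (hk : 1 ≤ k) :
    ∫ φ in (0 : ℝ)..2 * Real.pi,
      Real.log ‖(gegenbauerCirclePoly n).eval (Complex.exp (φ * Complex.I))‖ * Real.cos (k * φ) =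
      -(Real.pi / k) * ((gegenbauerCirclePoly n).roots.map fun ζ => ζ⁻¹ ^ k).sum.re := by
  have hcos : Continuous fun φ : ℝ => Real.cos (k * φ) := by fun_prop
  have hk0 : (k : ℝ) ≠ 0 := by exact_mod_cast (by omega : k ≠ 0)
  rw [intervalIntegral.integral_congr_ae
    ((log_norm_eval_gegenbauerCirclePoly_ae n).mono fun φ h _ => by rw [h, add_mul]),
    intervalIntegral.integral_add (Continuous.intervalIntegrable (by fun_prop) _ _)
      ((intervalIntegrable_sum_log_norm_exp_sub _).mul_continuousOn hcos.continuousOn),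
    integral_sum_log_norm_exp_sub_mul_cos _ (fun ζ => norm_of_mem_roots_gegenbauerCirclePoly) hk,
    intervalIntegral.integral_const_mul, intervalIntegral.integral_comp_mul_left _ hk0,
    integral_cos]
  have : Real.sin (k * (2 * Real.pi)) = 0 := by
    rw [← mul_assoc]
    exact_mod_cast Real.sin_nat_mul_pi (k * 2)
  simp [this]

/-- The 1/k in the cosine coefficients of log|P_n| lowers the cubic weights to quadratic ones. -/
theorem integral_gegenbauerTrigPoly_mul_log (n : ℕ) :
    ∫ φ in (0 : ℝ)..2 * Real.pi, gegenbauerTrigPoly n φ *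
      Real.log ‖(gegenbauerCirclePoly n).eval (Complex.exp (φ * Complex.I))‖ =
    2 * Real.pi * (((n : ℝ) + 1) * (n + 2) * (n + 4) * (n + 5) / 2
        * Real.log (((n : ℝ) + 1) * (n + 2) / 2)
      - ∑ k ∈ Finset.range (n + 2), (6 * ((k : ℝ) + 1) ^ 2 - 3 * ((n : ℝ) ^ 2 + 6 * n + 7))
        * ((gegenbauerCirclePoly n).roots.map fun ζ => ζ⁻¹ ^ (k + 1)).sum.re
      + ((n + 1) * (n + 2) / 2) ^ 2 / (n + 3)
        * ((gegenbauerCirclePoly n).roots.map fun ζ => ζ⁻¹ ^ (n + 3)).sum.re) := by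
  have hL := intervalIntegrable_log_norm_gegenbauerCirclePoly n
  have hI0 := integral_log_norm_gegenbauerCirclePoly n
  have hIk := fun k (hk : 1 ≤ k) => integral_log_norm_gegenbauerCirclePoly_mul_cos n (k := k) hk
  set L : ℝ → ℝ := fun φ =>
    Real.log ‖(gegenbauerCirclePoly n).eval (Complex.exp (φ * Complex.I))‖ with hLdef
  have hLc : ∀ k : ℕ, IntervalIntegrable (fun φ => L φ * Real.cos (k * φ)) MeasureTheory.volume 0
      (2 * Real.pi) := fun k => hL.mul_continuousOn (by fun_prop)
  have e : ∀ φ, gegenbauerTrigPoly n φ * L φ =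
      ((n : ℝ) + 1) * (n + 2) * (n + 4) * (n + 5) / 2 * L φ
      + ∑ k ∈ Finset.range (n + 2),
        2 * (6 * ((k : ℝ) + 1) ^ 3 - 3 * ((n : ℝ) ^ 2 + 6 * n + 7) * (k + 1))
          * (L φ * Real.cos ((k + 1 : ℕ) * φ))
      - 2 * ((n + 1) * (n + 2) / 2) ^ 2 * (L φ * Real.cos ((n + 3 : ℕ) * φ)) := by
    intro φ
    rw [gegenbauerTrigPoly, sub_mul, add_mul, Finset.sum_mul]
    congr 1
    · congr 1
      exact Finset.sum_congr rfl fun k _ => by ring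
    · ring
  change ∫ φ in (0 : ℝ)..2 * Real.pi, gegenbauerTrigPoly n φ * L φ = _
  simp_rw [e]
  have hsum : IntervalIntegrable (fun φ => ∑ k ∈ Finset.range (n + 2),
      2 * (6 * ((k : ℝ) + 1) ^ 3 - 3 * ((n : ℝ) ^ 2 + 6 * n + 7) * (k + 1))
        * (L φ * Real.cos ((k + 1 : ℕ) * φ))) MeasureTheory.volume 0 (2 * Real.pi) := by
    have := IntervalIntegrable.sum (Finset.range (n + 2)) (μ := MeasureTheory.volume)
      (a := 0) (b := 2 * Real.pi) (f := fun (k : ℕ) (φ : ℝ) =>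
        2 * (6 * ((k : ℝ) + 1) ^ 3 - 3 * ((n : ℝ) ^ 2 + 6 * n + 7) * (k + 1))
          * (L φ * Real.cos ((k + 1 : ℕ) * φ))) fun k _ => (hLc (k + 1)).const_mul _
    simpa [Finset.sum_fn] using this
  rw [intervalIntegral.integral_sub ((hL.const_mul _).add hsum) ((hLc (n + 3)).const_mul _),
    intervalIntegral.integral_add (hL.const_mul _) hsum,
    intervalIntegral.integral_finsetSum fun k _ => (hLc (k + 1)).const_mul _]
  simp only [intervalIntegral.integral_const_mul]
  rw [hI0, hIk (n + 3) (by omega)]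
  have e2 : ∀ k ∈ Finset.range (n + 2),
      2 * (6 * ((k : ℝ) + 1) ^ 3 - 3 * ((n : ℝ) ^ 2 + 6 * n + 7) * (k + 1))
        * ∫ φ in (0 : ℝ)..2 * Real.pi, L φ * Real.cos ((k + 1 : ℕ) * φ) =
      -(2 * Real.pi) * ((6 * ((k : ℝ) + 1) ^ 2 - 3 * ((n : ℝ) ^ 2 + 6 * n + 7))
        * ((gegenbauerCirclePoly n).roots.map fun ζ => ζ⁻¹ ^ (k + 1)).sum.re) := by
    intro k _
    rw [hIk (k + 1) (by omega)]
    have : (k : ℝ) + 1 ≠ 0 := by positivity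
    push_cast
    field_simp
  rw [Finset.sum_congr rfl e2, ← Finset.mul_sum]
  push_cast
  have : (n : ℝ) + 3 ≠ 0 := by positivity
  field_simp
  ring

/-! ### Closed-form summation. -/

/-- The hypothesis encodes s = 1/(ρ-1), so the geometric-type sum is polynomial in s with no
denominators. -/
theorem sum_quadratic_mul_pow (c : ℂ) {s ρ : ℂ} (h : s * ρ = s + 1) (M : ℕ) :
    ∑ k ∈ Finset.range M, (6 * ((k : ℂ) + 1) ^ 2 - c) * ρ ^ (k + 1) =
      s * (6 * ((M : ℂ) + 1) ^ 2 - 12 * (1 + s) * (M + 1) - c + 6 * (1 + s) * (1 + 2 * s))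
        * ρ ^ (M + 1) - (6 * s * (1 + s) * (1 + 2 * s) - c * s) + c := by
  induction M with
  | zero =>
    simp
    linear_combination (-(6 * s + 12 * s ^ 2 - c)) * h
  | succ M ih =>
    rw [Finset.sum_range_succ, ih]
    push_cast
    linear_combination (-(ρ ^ (M + 1) * (6 * ((M : ℂ) + 2) ^ 2 - 12 * (1 + s) * (M + 2) - c
      + 6 * (1 + s) * (1 + 2 * s)))) * h

theorem sum_quadratic (c : ℝ) (M : ℕ) :
    ∑ k ∈ Finset.range M, (6 * ((k : ℝ) + 1) ^ 2 - c) =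
      (M : ℝ) * (M + 1) * (2 * M + 1) - c * M := by
  induction M with
  | zero => simp
  | succ M ih =>
    rw [Finset.sum_range_succ, ih]
    push_cast
    ring

theorem neg_sum_quadratic_mul_pow_add (n : ℕ) {s ρ : ℂ} (hs0 : s ≠ 0) (h : s * ρ = s + 1)
    (hs : s ^ 2 - (n + 1) / 2 * s + (n + 1) * (n + 2) / 12 = 0) :
    -∑ k ∈ Finset.range (n + 2),
        (6 * ((k : ℂ) + 1) ^ 2 - 3 * ((n : ℂ) ^ 2 + 6 * n + 7)) * ρ ^ (k + 1)
      + ((n + 1) * (n + 2) / 2) ^ 2 / (n + 3) * ρ ^ (n + 3) =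
    (2 * ((n : ℂ) + 1) ^ 2 + 8 * (n + 1) + 6 - 3 * (n ^ 2 + 6 * n + 7)) * s
      - ((n : ℂ) + 1) ^ 2 * (n + 2) / 2 - 3 * (n + 1) * (n + 2) / 2
      - 3 * (n ^ 2 + 6 * n + 7)
      + (n + 5) ^ 2 / (4 * (n + 2) * (n + 3)) * (ρ ^ (n + 1)
        * (2 * (n : ℂ) ^ 2 + 13 * n + 14 - (n + 1) * (n + 6) * (n + 1 - 4 * s))) := by
  have h2 : (n : ℂ) + 2 ≠ 0 := by exact_mod_cast (by omega : n + 2 ≠ 0)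
  have h3 : (n : ℂ) + 3 ≠ 0 := by exact_mod_cast (by omega : n + 3 ≠ 0)
  rw [sum_quadratic_mul_pow _ h]
  push_cast
  have hR0 : 6 * s * (1 + s) * (1 + 2 * s) - 3 * ((n : ℂ) ^ 2 + 6 * n + 7) * s =
      (2 * ((n : ℂ) + 1) ^ 2 + 8 * (n + 1) + 6 - 3 * (n ^ 2 + 6 * n + 7)) * s
        - ((n : ℂ) + 1) ^ 2 * (n + 2) / 2 - 3 * (n + 1) * (n + 2) / 2 := by
    -- The multiplier is the quotient on dividing the cubic in s by the quadratic of `hs`.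
    linear_combination (12 * s + 6 * (n + 1) + 18) * hs
  rw [hR0]
  have hy : ρ ^ (n + 3) * (((n + 1) * (n + 2) / 2) ^ 2 / (n + 3)
      - s * (6 * ((n : ℂ) + 2 + 1) ^ 2 - 12 * (1 + s) * (n + 2 + 1) - 3 * (n ^ 2 + 6 * n + 7)
        + 6 * (1 + s) * (1 + 2 * s))) =
      (n + 5) ^ 2 / (4 * (n + 2) * (n + 3)) * (ρ ^ (n + 1)
        * (2 * (n : ℂ) ^ 2 + 13 * n + 14 - (n + 1) * (n + 6) * (n + 1 - 4 * s))) := by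
    have hsq : s ^ 2 * ρ ^ 2 = (s + 1) ^ 2 := by rw [← mul_pow, h]
    -- Multiplying by s² turns ρ^{n+3} into ρ^{n+1}(s+1)², leaving a polynomial in s to reduce by
    -- `hs`.
    refine mul_left_cancel₀ (pow_ne_zero 2 hs0) ?_
    have e : s ^ 2 * (ρ ^ (n + 3) * (((n + 1) * (n + 2) / 2) ^ 2 / (n + 3)
        - s * (6 * ((n : ℂ) + 2 + 1) ^ 2 - 12 * (1 + s) * (n + 2 + 1) - 3 * (n ^ 2 + 6 * n + 7)
          + 6 * (1 + s) * (1 + 2 * s)))) =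
        ρ ^ (n + 1) * ((s + 1) ^ 2 * (((n + 1) * (n + 2) / 2) ^ 2 / (n + 3)
        - s * (6 * ((n : ℂ) + 2 + 1) ^ 2 - 12 * (1 + s) * (n + 2 + 1) - 3 * (n ^ 2 + 6 * n + 7)
          + 6 * (1 + s) * (1 + 2 * s)))) := by
      rw [← hsq]; ring
    rw [e]
    field_simp
    linear_combination 4 * ρ ^ (n + 1) * (48 + 96 * n + 60 * n ^ 2 + 12 * n ^ 3
      + (-192 - 168 * n + 48 * n ^ 2 + 24 * n ^ 3) * s
      + (-288 - 96 * n + 72 * n ^ 2 + 24 * n ^ 3) * s ^ 2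
      + (-288 - 240 * n - 48 * n ^ 2) * s ^ 3) * hs
  linear_combination hy

/-! ### Change of variables and conclusion. -/

theorem continuous_gegenbauerC_three (n : ℕ) : Continuous (gegenbauerC n 3) := by
  have : gegenbauerC n 3 = fun x =>
      ∑ k ∈ Finset.range (n + 1), gegenbauerCoeff n k * ((1 - x) / 2) ^ k :=
    funext (gegenbauerC_three_eq_sum n (n + 1) n.lt_succ_self)
  rw [this]
  fun_prop

/-- Continuity of t log t at 0 removes the apparent singularities, so convergence of the integral is
immediate. -/
theorem continuous_gegenbauerEntropyIntegrand_three (n : ℕ) :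
    Continuous (gegenbauerEntropyIntegrand n 3) := by
  have hC := continuous_gegenbauerC_three n
  refine (Real.continuous_mul_log.comp (hC.pow 2)).mul ?_
  exact Continuous.rpow_const (by fun_prop) fun x => Or.inr (by norm_num)

theorem gegenbauerEntropyIntegrand_three_cos_mul_sin (n : ℕ) {θ : ℝ} (hθ : 0 < Real.sin θ) :
    gegenbauerEntropyIntegrand n 3 (Real.cos θ) * Real.sin θ =
      1 / 32 * (gegenbauerTrigPoly n (2 * θ) * Real.log
        ‖(gegenbauerCirclePoly n).eval (Complex.exp ((2 * θ : ℝ) * Complex.I))‖) := by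
  have hpow : (1 - Real.cos θ ^ 2) ^ ((3 : ℝ) - 1 / 2) = Real.sin θ ^ 5 := by
    rw [← Real.sin_sq, ← Real.rpow_natCast, ← Real.rpow_mul hθ.le,
      show ((2 : ℕ) : ℝ) * (3 - 1 / 2) = ((5 : ℕ) : ℝ) by norm_num, Real.rpow_natCast]
  set z := Complex.exp (θ * Complex.I) with hz
  have hw : Complex.exp (((2 * θ : ℝ) : ℂ) * Complex.I) = z ^ 2 := by
    rw [hz, ← Complex.exp_nat_mul]; push_cast; ring_nf
  have hquad : z ^ 2 + 1 = 2 * (Real.cos θ : ℝ) * z := by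
    push_cast
    rw [Complex.two_cos, add_mul, ← hz, hz, ← Complex.exp_add, ← Complex.exp_nat_mul,
      ← Complex.exp_add]
    simp
    ring_nf
  have hn : ‖(gegenbauerCirclePoly n).eval (z ^ 2)‖ = |gegenbauerC n 3 (Real.cos θ)| := by
    rw [← gegenbauerC_three_eq_eval n _ z hquad, norm_mul, norm_pow, hz,
      Complex.norm_exp_ofReal_mul_I, one_pow, one_mul, Complex.norm_real, Real.norm_eq_abs]
  rw [gegenbauerEntropyIntegrand, hpow, hw, hn, Real.log_abs,
    ← gegenbauerC_three_sq_mul_sin_pow n hθ.ne', Real.log_pow]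
  push_cast
  ring

/-- The 1/64 is the 1/32 of the pointwise identity times the 1/2 from φ = 2θ. -/
theorem gegenbauerEntropy_three_eq_integral (n : ℕ) :
    gegenbauerEntropy n 3 = -(1 / 64 * ∫ φ in (0 : ℝ)..2 * Real.pi, gegenbauerTrigPoly n φ *
      Real.log ‖(gegenbauerCirclePoly n).eval (Complex.exp (φ * Complex.I))‖) := by
  have hsub := intervalIntegral.integral_comp_mul_deriv (a := 0) (b := Real.pi)
    (f := Real.cos) (f' := fun θ => -Real.sin θ)
    (g := gegenbauerEntropyIntegrand n 3) (fun θ _ => Real.hasDerivAt_cos θ)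
    (by fun_prop) (continuous_gegenbauerEntropyIntegrand_three n)
  rw [Real.cos_zero, Real.cos_pi, intervalIntegral.integral_symm (-1) 1] at hsub
  have hcongr := intervalIntegral.integral_congr_Ioo_of_le (μ := MeasureTheory.volume)
    Real.pi_pos.le (f := fun θ => (gegenbauerEntropyIntegrand n 3 ∘ Real.cos) θ * -Real.sin θ)
    (g := fun θ => -(1 / 32) * (gegenbauerTrigPoly n (2 * θ) * Real.log
        ‖(gegenbauerCirclePoly n).eval (Complex.exp ((2 * θ : ℝ) * Complex.I))‖))
    (fun θ hθ => by
      have := gegenbauerEntropyIntegrand_three_cos_mul_sin n (Real.sin_pos_of_mem_Ioo hθ)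
      simp only [Function.comp_apply]
      linear_combination -this)
  rw [hcongr, intervalIntegral.integral_const_mul, intervalIntegral.integral_comp_mul_left
    (fun φ : ℝ => gegenbauerTrigPoly n φ * Real.log
        ‖(gegenbauerCirclePoly n).eval (Complex.exp (φ * Complex.I))‖) two_ne_zero,
    mul_zero, smul_eq_mul] at hsub
  rw [gegenbauerEntropy]
  linear_combination -hsub

theorem gegenbauer_power_sum_closed_form (n : ℕ) :
    -∑ k ∈ Finset.range (n + 2), (6 * ((k : ℝ) + 1) ^ 2 - 3 * ((n : ℝ) ^ 2 + 6 * n + 7))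
        * ((gegenbauerCirclePoly n).roots.map fun ζ => ζ⁻¹ ^ (k + 1)).sum.re
      + (((n : ℝ) + 1) * (n + 2) / 2) ^ 2 / (n + 3)
        * ((gegenbauerCirclePoly n).roots.map fun ζ => ζ⁻¹ ^ (n + 3)).sum.re =
    1 / 4 * (((n : ℝ) ^ 5 - 16 * (n : ℝ) ^ 4 - 269 * (n : ℝ) ^ 3 - 1200 * (n : ℝ) ^ 2
              - 2102 * (n : ℝ) - 1250) / ((n : ℝ) + 3)
          + 2 * ((n : ℝ) + 5) ^ 2 / (((n : ℝ) + 2) * ((n : ℝ) + 3)) *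
            Complex.re
              (((((n : ℂ) + 1) * ((n : ℂ) + 5)
                    + Complex.I * (Real.sqrt (3 * ((n : ℝ) + 1) * ((n : ℝ) + 5)) : ℂ))
                  / (((n : ℂ) + 1) * ((n : ℂ) + 2))) ^ (n + 1)
                * (2 * (n : ℂ) ^ 2 + 13 * (n : ℂ) + 14
                    - Complex.I * ((n : ℂ) + 1) * ((n : ℂ) + 6)
                      * (Real.sqrt (((n : ℝ) + 1) * ((n : ℝ) + 5) / 3) : ℂ)))) := by
  have h1 : (n : ℂ) + 1 ≠ 0 := by exact_mod_cast (by omega : n + 1 ≠ 0)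
  have h2 : (n : ℂ) + 2 ≠ 0 := by exact_mod_cast (by omega : n + 2 ≠ 0)
  set σ := Real.sqrt (3 * ((n : ℝ) + 1) * ((n : ℝ) + 5)) with hσ
  have hσ3 : Real.sqrt (((n : ℝ) + 1) * ((n : ℝ) + 5) / 3) = σ / 3 := by
    rw [hσ, show ((n : ℝ) + 1) * ((n : ℝ) + 5) / 3 = (3 * ((n : ℝ) + 1) * ((n : ℝ) + 5)) / 3 ^ 2
      by ring, Real.sqrt_div' _ (by positivity), Real.sqrt_sq (by norm_num)]
  have hσ2 : (σ : ℂ) ^ 2 = 3 * (n + 1) * (n + 5) := by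
    have : σ ^ 2 = 3 * ((n : ℝ) + 1) * (n + 5) := Real.sq_sqrt (by positivity)
    exact_mod_cast this
  rw [hσ3]
  set ρ : ℂ := (((n : ℂ) + 1) * ((n : ℂ) + 5) + Complex.I * (σ : ℂ))
    / (((n : ℂ) + 1) * ((n : ℂ) + 2)) with hρ
  set ρ' : ℂ := (((n : ℂ) + 1) * ((n : ℂ) + 5) - Complex.I * (σ : ℂ))
    / (((n : ℂ) + 1) * ((n : ℂ) + 2)) with hρ'
  have hconj : ρ' = (starRingEnd ℂ) ρ := by
    rw [hρ, hρ']
    simp [sub_eq_add_neg, Complex.conj_ofNat]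
  have hI := Complex.I_sq
  have hadd : ((n : ℂ) + 2) * (ρ + ρ') = 2 * (n + 5) := by
    rw [hρ, hρ']; field_simp; ring
  have hmul : ((n : ℂ) + 1) * (n + 2) * (ρ * ρ') = (n + 4) * (n + 5) := by
    rw [hρ, hρ']; field_simp
    linear_combination (-(σ : ℂ) ^ 2) * hI + hσ2
  have hre : ∀ k : ℕ, (ρ' ^ k).re = (ρ ^ k).re := fun k => by
    rw [hconj, ← map_pow, Complex.conj_re]
  -- This is 1/(ρ-1) after rationalising with σ² = 3(n+1)(n+5).
  set s : ℂ := (3 * (n + 1) - Complex.I * σ) / 12 with hs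
  have hsρ : s * ρ = s + 1 := by
    rw [hs, hρ]; field_simp
    linear_combination (-(σ : ℂ) ^ 2) * hI + hσ2
  have hs2 : s ^ 2 - (n + 1) / 2 * s + (n + 1) * (n + 2) / 12 = 0 := by
    rw [hs]
    linear_combination (σ : ℂ) ^ 2 / 144 * hI - hσ2 / 144
  have hs0 : s ≠ 0 := by
    intro h
    rw [h] at hs2
    simp [h1, h2] at hs2
  have hW : 2 * (n : ℂ) ^ 2 + 13 * (n : ℂ) + 14
      - Complex.I * ((n : ℂ) + 1) * ((n : ℂ) + 6) * ((σ / 3 : ℝ) : ℂ) =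
      2 * (n : ℂ) ^ 2 + 13 * n + 14 - (n + 1) * (n + 6) * (n + 1 - 4 * s) := by
    rw [hs]; push_cast; ring
  rw [hW]
  set Z := ρ ^ (n + 1) * (2 * (n : ℂ) ^ 2 + 13 * n + 14 - (n + 1) * (n + 6) * (n + 1 - 4 * s))
    with hZ
  have hsre : s.re = ((n : ℝ) + 1) / 4 := by
    have : s = ((((n : ℝ) + 1) / 4 : ℝ) : ℂ) + Complex.I * ((-σ / 12 : ℝ) : ℂ) := by
      rw [hs]; push_cast; ring
    rw [this]; simp
  have key := neg_sum_quadratic_mul_pow_add n hs0 hsρ hs2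
  have key' : -∑ k ∈ Finset.range (n + 2),
        ((6 * ((k : ℝ) + 1) ^ 2 - 3 * ((n : ℝ) ^ 2 + 6 * n + 7) : ℝ) : ℂ) * ρ ^ (k + 1)
      + (((((n : ℝ) + 1) * (n + 2) / 2) ^ 2 / (n + 3) : ℝ) : ℂ) * ρ ^ (n + 3) =
      ((2 * ((n : ℝ) + 1) ^ 2 + 8 * (n + 1) + 6 - 3 * (n ^ 2 + 6 * n + 7) : ℝ) : ℂ) * s
      - ((((n : ℝ) + 1) ^ 2 * (n + 2) / 2 + 3 * (n + 1) * (n + 2) / 2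
        + 3 * (n ^ 2 + 6 * n + 7) : ℝ) : ℂ)
      + ((((n : ℝ) + 5) ^ 2 / (4 * (n + 2) * (n + 3)) : ℝ) : ℂ) * Z := by
    push_cast
    rw [key]
    ring
  have hkey := congrArg Complex.re key'
  simp only [Complex.add_re, Complex.neg_re, Complex.sub_re, Complex.re_sum,
    Complex.re_ofReal_mul, Complex.ofReal_re, hsre] at hkey
  have hp : ∀ k ∈ Finset.range (n + 2),
      (6 * ((k : ℝ) + 1) ^ 2 - 3 * ((n : ℝ) ^ 2 + 6 * n + 7))
        * ((gegenbauerCirclePoly n).roots.map fun ζ => ζ⁻¹ ^ (k + 1)).sum.re =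
      2 * ((6 * ((k : ℝ) + 1) ^ 2 - 3 * ((n : ℝ) ^ 2 + 6 * n + 7)) * (ρ ^ (k + 1)).re)
        - 5 * (6 * ((k : ℝ) + 1) ^ 2 - 3 * ((n : ℝ) ^ 2 + 6 * n + 7)) := by
    intro k hk
    have hk' : k < n + 2 := Finset.mem_range.1 hk
    rw [sum_inv_pow_roots_gegenbauerCirclePoly n hadd hmul (by omega) (by omega),
      if_neg (by omega), add_zero,
      Complex.sub_re, Complex.add_re, hre, Complex.re_ofNat]
    ring
  have hpm : ((gegenbauerCirclePoly n).roots.map fun ζ => ζ⁻¹ ^ (n + 3)).sum.re =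
      2 * (ρ ^ (n + 3)).re - 5
        + ((n : ℝ) + 3) * ((n + 4) * (n + 5)) / ((n + 1) * (n + 2)) := by
    have e : ((n : ℂ) + 3) * ((n + 4) * (n + 5)) / ((n + 1) * (n + 2)) =
        ((((n : ℝ) + 3) * ((n + 4) * (n + 5)) / ((n + 1) * (n + 2)) : ℝ) : ℂ) := by
      push_cast; rfl
    rw [sum_inv_pow_roots_gegenbauerCirclePoly n hadd hmul (by omega) le_rfl, if_pos rfl, e,
      Complex.add_re,
      Complex.ofReal_re, Complex.sub_re, Complex.add_re, hre, Complex.re_ofNat]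
    ring
  rw [Finset.sum_congr rfl hp, Finset.sum_sub_distrib, ← Finset.mul_sum, ← Finset.mul_sum,
    sum_quadratic, hpm]
  have hn1 : (n : ℝ) + 1 ≠ 0 := by positivity
  have hn2 : (n : ℝ) + 2 ≠ 0 := by positivity
  have hn3 : (n : ℝ) + 3 ≠ 0 := by positivity
  -- S stands for the weighted sum of Re ρ^k and T for Re ρ^{n+3}; with both abstracted, the claim
  -- is a rational identity in n.
  have hgoal : ∀ S T : ℝ, -S + (((n : ℝ) + 1) * (n + 2) / 2) ^ 2 / (n + 3) * T =
      (2 * ((n : ℝ) + 1) ^ 2 + 8 * (n + 1) + 6 - 3 * (n ^ 2 + 6 * n + 7)) * ((n + 1) / 4)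
      - (((n : ℝ) + 1) ^ 2 * (n + 2) / 2 + 3 * (n + 1) * (n + 2) / 2
        + 3 * (n ^ 2 + 6 * n + 7))
      + ((n : ℝ) + 5) ^ 2 / (4 * (n + 2) * (n + 3)) * Z.re →
      -(2 * S - 5 * (((n + 2 : ℕ) : ℝ) * ((n + 2 : ℕ) + 1) * (2 * (n + 2 : ℕ) + 1)
        - 3 * ((n : ℝ) ^ 2 + 6 * n + 7) * (n + 2 : ℕ)))
      + (((n : ℝ) + 1) * (n + 2) / 2) ^ 2 / (n + 3) * (2 * T - 5
        + ((n : ℝ) + 3) * ((n + 4) * (n + 5)) / ((n + 1) * (n + 2))) =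
      1 / 4 * (((n : ℝ) ^ 5 - 16 * (n : ℝ) ^ 4 - 269 * (n : ℝ) ^ 3 - 1200 * (n : ℝ) ^ 2
        - 2102 * (n : ℝ) - 1250) / ((n : ℝ) + 3)
        + 2 * ((n : ℝ) + 5) ^ 2 / (((n : ℝ) + 2) * ((n : ℝ) + 3)) * Z.re) := by
    intro S T h
    have hS := eq_sub_of_add_eq h
    have hS' : S = -(-S) := by ring
    rw [hS', hS]
    push_cast
    field_simp
    ring
  exact hgoal _ _ hkey

theorem mainTheorem1 (n : ℕ) :
    IntervalIntegrable (gegenbauerEntropyIntegrand n 3) MeasureTheory.volume (-1) 1 ∧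
    gegenbauerEntropy n 3 =
      -(Real.pi / 128) *
        (2 * ((n : ℝ) + 1) * ((n : ℝ) + 2) * ((n : ℝ) + 4) * ((n : ℝ) + 5) *
            Real.log (((n : ℝ) + 1) * ((n : ℝ) + 2) / 2)
          + ((n : ℝ) ^ 5 - 16 * (n : ℝ) ^ 4 - 269 * (n : ℝ) ^ 3 - 1200 * (n : ℝ) ^ 2
              - 2102 * (n : ℝ) - 1250) / ((n : ℝ) + 3)
          + 2 * ((n : ℝ) + 5) ^ 2 / (((n : ℝ) + 2) * ((n : ℝ) + 3)) *
            Complex.re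
              (((((n : ℂ) + 1) * ((n : ℂ) + 5)
                    + Complex.I * (Real.sqrt (3 * ((n : ℝ) + 1) * ((n : ℝ) + 5)) : ℂ))
                  / (((n : ℂ) + 1) * ((n : ℂ) + 2))) ^ (n + 1)
                * (2 * (n : ℂ) ^ 2 + 13 * (n : ℂ) + 14
                    - Complex.I * ((n : ℂ) + 1) * ((n : ℂ) + 6)
                      * (Real.sqrt (((n : ℝ) + 1) * ((n : ℝ) + 5) / 3) : ℂ)))) := by
  refine ⟨(continuous_gegenbauerEntropyIntegrand_three n).intervalIntegrable _ _, ?_⟩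
  rw [gegenbauerEntropy_three_eq_integral, integral_gegenbauerTrigPoly_mul_log]
  linear_combination (-(Real.pi / 32)) * gegenbauer_power_sum_closed_form n
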